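/- Let $\alpha,\beta>-1$ and let $m\ge 0$ be an integer. **Setting.** For $a,b>-1$ let $w^*_{a,b}$ be the Jacobi weight $(1-t)^a(1+t)^b$ on $[-1,1]$ normalized to have integral $1$, and let $p_n^{(a,b)}$ be its orthonormal polynomials (orthonormal Jacobi polynomials, positive leading coefficients). Let $0=\theta_0<\theta_1<\dots<\theta_m<\pi$, where $x_k=\cos\theta_k$ $(1\le k\le m)$ are the zeros of $p_m^{(\alpha+1,\beta)}$ and $x_0=1$, and let $\mu_0,\dots,\mu_m$ be the coefficients of the Gauss–Radau rule $\int f\,w^*_{\alpha,\beta}=\sum_{k=0}^m\mu_kf(x_k)$ for polynomials $f$ of degree at most $2m$. Put $$\widehat h_l=\sum_{k=0}^m\mu_k(1+x_k)\big[p_l^{(\alpha,\beta+1)}(x_k)\big]^2,\qquad 0\le l\le m .$$ For $0\le j\le k\le m$ let $s_{j,k}=\cos\frac{\theta_j-\theta_k}2$, $t_{j,k}=\cos\frac{\theta_j+\theta_k}2$ and $$\mathbf x^{(1)}_{j,k}=(s_{j,k},t_{j,k}),\quad \mathbf x^{(2)}_{j,k}=(t_{j,k},s_{j,k}),\quad \mathbf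 x^{(3)}_{j,k}=-(s_{j,k},t_{j,k}),\quad \mathbf x^{(4)}_{j,k}=-(t_{j,k},s_{j,k}),$$ and let $X_m$ be the set of all these points (for $j=0$ they coincide in pairs). Let $\mathcal W_{\alpha,\beta}(x_1,x_2)=c\,|x_1-x_2|^{2\alpha+1}|x_1+x_2|^{2\beta+1}(1-x_1^2)^{-1/2}(1-x_2^2)^{-1/2}$ on $[-1,1]^2$ and $W_{a,b}(u,v)=b_{a,b}(1-u+v)^a(1+u+v)^b(u^2-4v)^{-1/2}$ on the bounded domain $\Omega=\{1+u+v>0,\ 1-u+v>0,\ u^2>4v,\ |u|<2\}$, the constants $c$, $b_{a,b}$ being such that both weights have integral $1$. Let $\mathcal K_{2m}$ be the reproducing kernel of the polynomials of total degree at most $2m$ in $L^2(\mathcal W_{\alpha,\beta})$, and $K_r$ that of the polynomials of total degree at most $r$ in $L^2(W_{\alpha,\beta+1})$ (with $K_{-1}=0$). For $0\le k\le m$ let $P_{k,m}(u,v)$ be the polynomial that at $u=x+y$, $v=xy$ equals $\frac1{\sqrt2}\big(p_m(x)p_k(y)+p_m(y)p_k(x)\big)$ if $k<m$ and $p_m(x)p_m(y)$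 if $k=m$, with $p_i=p_i^{(\alpha,\beta+1)}$. Let $a=\sqrt{b_{\alpha,\beta+1}/b_{\alpha,\beta}}$, $$Q_k(x_1,x_2)=a\,(x_1+x_2)\,P_{k,m}(2x_1x_2,\;x_1^2+x_2^2-1),\qquad 0\le k\le m,$$ and let $\Pi^*_{2m+1}$ be the sum of the space of polynomials of total degree at most $2m$ and $\operatorname{span}\{Q_0,\dots,Q_m\}$. For a function $\mathcal K$ of two points $x,y\in\mathbb R^2$ put $$\mathcal L[\mathcal K]f(x)=\sum_{k=0}^m\sum_{j=0}^k\sum_{i=1}^4 f(\mathbf x^{(i)}_{j,k})\,\ell^{(i)}_{j,k}(x),\qquad \ell^{(i)}_{j,k}(x)=\tfrac12\mu_j\mu_k\,\mathcal K(x,\mathbf x^{(i)}_{j,k}),$$ where $\frac12$ is replaced by $\frac14$ when $j=k$ (the sum is taken over all indices, so coinciding points are counted with repetition). **Theorem.** Let $$\mathcal K^*_{2m+1}(x,y)=\mathcal K_{2m}(x,y)+\frac{(x_1+x_2)(y_1+y_2)}{\widehat h_0\,\widehat h_m}\Big[K_m(X,Y)-K_{m-1}(X,Y)+\Big(\frac{\widehat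 h_0}{\widehat h_m}-1\Big)P_{m,m}(X)P_{m,m}(Y)\Big],$$ with $X=(2x_1x_2,x_1^2+x_2^2-1)$ and $Y=(2y_1y_2,y_1^2+y_2^2-1)$. 1. For every $f$, $\mathcal L[\mathcal K^*_{2m+1}]f$ belongs to $\Pi^*_{2m+1}$, agrees with $f$ on $X_m$, and is the only element of $\Pi^*_{2m+1}$ that does so. 2. The numbers $b_{k,m}=\big(a^2\,\widehat h_k\,\widehat h_m\big)^{-1}$, $0\le k\le m$, are positive, and they are the only real numbers $b_0,\dots,b_m$ for which, with $\mathcal K=\mathcal K_{2m}+\sum_{k=0}^m b_k\,Q_k(x)Q_k(y)$, the function $\mathcal L[\mathcal K]f$ agrees with $f$ on $X_m$ for every $f$. 3. $\mathcal K^*_{2m+1}(x,y)=\mathcal K_{2m}(x,y)+\sum_{k=0}^m b_{k,m}\,Q_k(x)Q_k(y)$ for all $x,y\in\mathbb R^2$. -/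

import Mathlib

open MeasureTheory Polynomial

noncomputable section

namespace JacobiCubature

/-! ### Jacobi weight, orthonormal Jacobi polynomials, Gauss-Radau rule -/

/-- The Jacobi weight `(1 - t)^α (1 + t)^β` on `[-1,1]`. -/
def jacWeight (α β t : ℝ) : ℝ := (1 - t) ^ α * (1 + t) ^ β

/-- Integral of `f` over `[-1,1]` against the Jacobi weight normalized to total mass one. -/
def jacMean (α β : ℝ) (f : ℝ → ℝ) : ℝ :=
  (∫ t in (-1 : ℝ)..1, f t * jacWeight α β t) / ∫ t in (-1 : ℝ)..1, jacWeight α β t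

/-- The monic orthogonal polynomials of the Jacobi weight (Gram-Schmidt applied to the
monomials); these are the Jacobi polynomials up to positive constant factors. -/
def jacMonic (α β : ℝ) : ℕ → ℝ[X]
  | n => X ^ n - ∑ k : Fin n,
      C (jacMean α β (fun t => t ^ n * (jacMonic α β k).eval t) /
          jacMean α β (fun t => ((jacMonic α β k).eval t) ^ 2)) * jacMonic α β k
  decreasing_by all_goals exact k.isLt

/-- The orthonormal Jacobi polynomial `p_n^{(α,β)}` of the normalized Jacobi weight
(with positive leading coefficient). -/
def jac (α β : ℝ) (n : ℕ) : ℝ[X] :=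
  C (Real.sqrt (jacMean α β (fun t => ((jacMonic α β n).eval t) ^ 2)))⁻¹ * jacMonic α β n

/-- The Gauss-Radau nodes: `x_0 = 1`, and `x_1 > x_2 > ⋯ > x_m` are the zeros of the Jacobi
polynomial of degree `m` with parameters `(α + 1, β)`. Only the indices `0 ≤ k ≤ m` matter. -/
def radauNode (α β : ℝ) (m k : ℕ) : ℝ :=
  (1 :: (jac (α + 1) β m).roots.sort (· ≥ ·)).getD k 0

/-- The angles `0 = θ_0 < θ_1 < ⋯ < θ_m < π` with `cos θ_k = x_k`. -/
def radauAngle (α β : ℝ) (m k : ℕ) : ℝ := Real.arccos (radauNode α β m k)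

/-- The coefficients `μ_k` of the Gauss-Radau rule
`∫ f w* = ∑_{k=0}^m μ_k f(x_k)`, as the integrals of the Lagrange basis polynomials. -/
def radauCoeff (α β : ℝ) (m k : ℕ) : ℝ :=
  jacMean α β
    (fun t => (Lagrange.basis (Finset.range (m + 1)) (radauNode α β m) k).eval t)

/-- `ĥ_l = ∑_{k=0}^m μ_k (1 + x_k) p_l^{(α,β+1)}(x_k)^2`. -/
def hHat (α β : ℝ) (m l : ℕ) : ℝ :=
  ∑ k ∈ Finset.range (m + 1), radauCoeff α β m k * (1 + radauNode α β m k) *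
    ((jac α (β + 1) l).eval (radauNode α β m k)) ^ 2

/-! ### Symmetric polynomials in the variables `u = x + y`, `v = x y` -/

/-- The power sum `x^n + y^n` as a polynomial in `u = x + y` and `v = x y`. -/
def powSum (u v : ℝ) : ℕ → ℝ
  | 0 => 2
  | 1 => u
  | n + 2 => u * powSum u v (n + 1) - v * powSum u v n

/-- `q x + q y` as a polynomial in `u = x + y` and `v = x y`. -/
def symSum (q : ℝ[X]) (u v : ℝ) : ℝ := q.sum fun n a => a * powSum u v n

/-- `q x * r y + q y * r x` as a polynomial in `u = x + y` and `v = x y`; defined for all real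
`u, v`, also where `x, y` would not be real. -/
def symProd (q r : ℝ[X]) (u v : ℝ) : ℝ := symSum q u v * symSum r u v - symSum (q * r) u v

theorem powSum_add_mul (x y : ℝ) (n : ℕ) : powSum (x + y) (x * y) n = x ^ n + y ^ n := by
  induction n using Nat.twoStepInduction with
  | zero => norm_num [powSum]
  | one => simp [powSum]
  | more n h1 h2 => rw [powSum, h1, h2]; ring

theorem symSum_add_mul (q : ℝ[X]) (x y : ℝ) :
    symSum q (x + y) (x * y) = q.eval x + q.eval y := by
  simp only [symSum, powSum_add_mul, Polynomial.eval_eq_sum, Polynomial.sum_def, mul_add,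
    Finset.sum_add_distrib]

theorem symProd_add_mul (q r : ℝ[X]) (x y : ℝ) :
    symProd q r (x + y) (x * y) = q.eval x * r.eval y + q.eval y * r.eval x := by
  simp only [symProd, symSum_add_mul, Polynomial.eval_mul]; ring

/-! ### The weights on the parabolic triangle and on the square -/

/-- The domain bounded by the parabola `u^2 = 4 v` and the lines `1 + u + v = 0`,
`1 - u + v = 0`; the condition `|u| < 2` selects the bounded component. -/
def parTriangle : Set (ℝ × ℝ) :=
  {p | 0 < 1 + p.1 + p.2 ∧ 0 < 1 - p.1 + p.2 ∧ 4 * p.2 < p.1 ^ 2 ∧ |p.1| < 2}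

/-- `(1 - u + v)^α (1 + u + v)^β (u^2 - 4 v)^{-1/2}`, not normalized. -/
def triWeight (α β : ℝ) (p : ℝ × ℝ) : ℝ :=
  (1 - p.1 + p.2) ^ α * (1 + p.1 + p.2) ^ β * (p.1 ^ 2 - 4 * p.2) ^ (-(1 / 2) : ℝ)

/-- The reciprocal of the normalization constant `b_{α,β,-1/2}` of `triWeight`. -/
def triMass (α β : ℝ) : ℝ := ∫ p in parTriangle, triWeight α β p

/-- Integral against the weight `triWeight`, normalized to total mass one. -/
def triMean (α β : ℝ) (f : ℝ × ℝ → ℝ) : ℝ :=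
  (∫ p in parTriangle, f p * triWeight α β p) / triMass α β

/-- The square `[-1,1]^2`. -/
def square : Set (ℝ × ℝ) := Set.Icc (-1) 1 ×ˢ Set.Icc (-1) 1

/-- `|x - y|^{2α+1} |x + y|^{2β+1} (1 - x^2)^{-1/2} (1 - y^2)^{-1/2}`, not normalized. -/
def sqWeight (α β : ℝ) (p : ℝ × ℝ) : ℝ :=
  |p.1 - p.2| ^ (2 * α + 1) * |p.1 + p.2| ^ (2 * β + 1) *
    (1 - p.1 ^ 2) ^ (-(1 / 2) : ℝ) * (1 - p.2 ^ 2) ^ (-(1 / 2) : ℝ)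

/-- Integral over the square against the weight `sqWeight`, normalized to total mass one. -/
def sqMean (α β : ℝ) (f : ℝ × ℝ → ℝ) : ℝ :=
  (∫ p in square, f p * sqWeight α β p) / ∫ p in square, sqWeight α β p

/-! ### Polynomial spaces in two variables and their reproducing kernels -/

/-- Exponents of the monomials `x^i y^j` of total degree less than `N`. -/
def monoIdx (N : ℕ) : Finset (ℕ × ℕ) :=
  (Finset.range N ×ˢ Finset.range N).filter fun e => e.1 + e.2 < N

/-- The monomial `x^i y^j`. -/
def mono (e : ℕ × ℕ) (p : ℝ × ℝ) : ℝ := p.1 ^ e.1 * p.2 ^ e.2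

/-- The space of real polynomials in two variables of total degree less than `N`
(as functions on `ℝ × ℝ`). -/
def polyLT (N : ℕ) : Submodule ℝ (ℝ × ℝ → ℝ) :=
  Submodule.span ℝ (mono '' (monoIdx N : Set (ℕ × ℕ)))

/-- The Gram matrix of the monomials of total degree less than `N` for the inner product
`⟨f, g⟩ = I (f g)`. -/
def gram (I : (ℝ × ℝ → ℝ) → ℝ) (N : ℕ) : Matrix (monoIdx N) (monoIdx N) ℝ :=
  Matrix.of fun d e => I fun p => mono d p * mono e p

/-- The reproducing kernel of the space of polynomials of total degree less than `N`, for the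
inner product `⟨f, g⟩ = I (f g)`. -/
def polyKernel (I : (ℝ × ℝ → ℝ) → ℝ) (N : ℕ) (x y : ℝ × ℝ) : ℝ :=
  ∑ d : monoIdx N, ∑ e : monoIdx N, (gram I N)⁻¹ d e * mono d x * mono e y

/-! ### Orthonormal polynomials -/

/-- The orthonormal polynomials `P_{k,n}^{α,β,-1/2}`, `0 ≤ k ≤ n`, on the parabolic triangle
(for the weight of total mass one): at `u = x + y`, `v = x y` the value is
`(p_n x * p_k y + p_n y * p_k x) / √2` if `k < n`, and `p_n x * p_n y` if `k = n`. -/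
def triP (α β : ℝ) (k n : ℕ) (p : ℝ × ℝ) : ℝ :=
  symProd (jac α β n) (jac α β k) p.1 p.2 / (if k = n then 2 else Real.sqrt 2)

/-- The map `(x, y) ↦ (2 x y, x^2 + y^2 - 1)` from the square to the parabolic triangle. -/
def toTri (x : ℝ × ℝ) : ℝ × ℝ := (2 * x.1 * x.2, x.1 ^ 2 + x.2 ^ 2 - 1)

/-- `a_{α,β,-1/2}^{(0,1)} = √(b_{α,β+1,-1/2} / b_{α,β,-1/2})`. -/
def aConst (α β : ℝ) : ℝ := Real.sqrt (triMass α β / triMass α (β + 1))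

/-- The polynomials `₁Q_{k,2m+1}^{α,β}`, `0 ≤ k ≤ m`, of degree `2m + 1`, orthonormal on the
square. -/
def oneQ (α β : ℝ) (m k : ℕ) (x : ℝ × ℝ) : ℝ :=
  aConst α β * (x.1 + x.2) * triP α (β + 1) k m (toTri x)

/-! ### Nodes, kernels and interpolation -/

/-- The nodes `x_{j,k}^{(i)}`, `i = 1, 2, 3, 4` (here `i = 0, 1, 2, 3`). -/
def node (α β : ℝ) (m j k : ℕ) (i : Fin 4) : ℝ × ℝ :=
  let s := Real.cos ((radauAngle α β m j - radauAngle α β m k) / 2)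
  let t := Real.cos ((radauAngle α β m j + radauAngle α β m k) / 2)
  ![(s, t), (t, s), (-s, -t), (-t, -s)] i

/-- The set `X_m` of all nodes. -/
def nodeSet (α β : ℝ) (m : ℕ) : Set (ℝ × ℝ) :=
  {p | ∃ j k : ℕ, ∃ i : Fin 4, j ≤ k ∧ k ≤ m ∧ p = node α β m j k i}

/-- `Π*_{2m+1}`: polynomials of total degree at most `2m`, plus the span of the
`₁Q_{k,2m+1}^{α,β}`, `0 ≤ k ≤ m`. -/
def interpSpace (α β : ℝ) (m : ℕ) : Submodule ℝ (ℝ × ℝ → ℝ) :=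
  polyLT (2 * m + 1) ⊔ Submodule.span ℝ (oneQ α β m '' Set.Iic m)

/-- The kernel `𝒦_{2m}(x,y) + ∑_{k=0}^m b_k ₁Q_{k,2m+1}(x) ₁Q_{k,2m+1}(y)`. -/
def coeffKernel (α β : ℝ) (m : ℕ) (b : ℕ → ℝ) (x y : ℝ × ℝ) : ℝ :=
  polyKernel (sqMean α β) (2 * m + 1) x y +
    ∑ k ∈ Finset.range (m + 1), b k * oneQ α β m k x * oneQ α β m k y

/-- The explicit kernel `𝒦*_{2m+1}`. The two kernels on the parabolic triangle are those of
the polynomials of degree at most `m` and at most `m - 1` (zero if `m = 0`). -/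
def starKernel (α β : ℝ) (m : ℕ) (x y : ℝ × ℝ) : ℝ :=
  polyKernel (sqMean α β) (2 * m + 1) x y +
    1 / (hHat α β m 0 * hHat α β m m) * (x.1 + x.2) * (y.1 + y.2) *
      (polyKernel (triMean α (β + 1)) (m + 1) (toTri x) (toTri y) -
        polyKernel (triMean α (β + 1)) m (toTri x) (toTri y) +
        (hHat α β m 0 / hHat α β m m - 1) *
          triP α (β + 1) m m (toTri x) * triP α (β + 1) m m (toTri y))

/-- The fundamental polynomials `ℓ_{j,k}^{(i)}` built from a kernel `K`. -/
def fundPoly (α β : ℝ) (m : ℕ) (K : ℝ × ℝ → ℝ × ℝ → ℝ) (j k : ℕ) (i : Fin 4)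
    (x : ℝ × ℝ) : ℝ :=
  (if j = k then 1 / 4 else 1 / 2) * radauCoeff α β m j * radauCoeff α β m k *
    K x (node α β m j k i)

/-- `∑_{k=0}^m ∑_{j=0}^k ∑_i f(x_{j,k}^{(i)}) ℓ_{j,k}^{(i)}`. -/
def interp (α β : ℝ) (m : ℕ) (K : ℝ × ℝ → ℝ × ℝ → ℝ) (f : ℝ × ℝ → ℝ)
    (x : ℝ × ℝ) : ℝ :=
  ∑ k ∈ Finset.range (m + 1), ∑ j ∈ Finset.range (k + 1), ∑ i : Fin 4,
    f (node α β m j k i) * fundPoly α β m K j k i x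

end JacobiCubature

end

open JacobiCubature

noncomputable section

namespace JacobiCubature

/-! ### Integration against the Jacobi weight as a linear functional on polynomials -/

/-! The map `toTri` is invariant under the reflections of the square in its two diagonals, and it
sends a node with indices `j, k` to `symMap (x_j, x_k)` (`toTri_node_zero`). On functions of `toTri`
the integral over the square thus becomes a product of two Jacobi integrals, and the node sum a
product of two Gauss-Radau sums. Symmetrizing an even polynomial of degree `2n` gives degree at most
`n` in each new variable, while odd polynomials vanish on both sides. Exactness of the Radau rule up
to degree `2m` therefore makes the node sum exact up to degree `4m` (`nodeSum_mono`).

Products `Q_k Q_l` have degree `4m + 2`, out of this range. But `(x_1 + x_2)^2` becomes `(1 + x)(1 +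
y)`, which turns `μ_k` into the weights `μ_k (1 + x_k)`. For these the `p_l^{(α,β+1)}`, `l ≤ m`, are
still orthogonal, with squared norms `ĥ_l`. So for the node sum the `Q_k` are orthogonal to each
other, with squared norms `D_k = a^2 ĥ_k ĥ_m`, and to all polynomials of degree at most `2m`
(`nodeSum_oneQ_mul_oneQ`, `nodeSum_mono_mul_oneQ`).

The rest is linear algebra. In the basis of monomials and `Q_k`, the discrete Gram matrix is block
diagonal with blocks `G` (the continuous Gram matrix) and `diag D_k`, and the kernel has coefficient
blocks `G⁻¹` and `diag b_k`. Hence "evaluate, then interpolate" is the block matrix of `1` and `diag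
(b_k D_k)`, the identity exactly for `b_k = 1 / D_k`. There are at most `2(m+1)^2` nodes, and the
basis has exactly that many elements. A left inverse of evaluation forces equality, so it is also a
right inverse: the left inverse property gives uniqueness, the right one interpolation.

For the closed form, `K_m - K_{m-1}` is the sum of the `P_{k,m} P_{k,m}` (`polyKernel_triMean_sub`),
and `ĥ_k = ĥ_0` for `k < m` (`hHat_eq`), so only the term with `k = m` needs a correction. -/

theorem jacWeight_pos (α β : ℝ) {t : ℝ} (h1 : -1 < t) (h2 : t < 1) : 0 < jacWeight α β t :=
  mul_pos (Real.rpow_pos_of_pos (by linarith) _) (Real.rpow_pos_of_pos (by linarith) _)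

theorem intervalIntegrable_jacWeight {α β : ℝ} (hα : -1 < α) (hβ : -1 < β) :
    IntervalIntegrable (jacWeight α β) volume (-1) 1 := by
  refine IntervalIntegrable.trans (b := 0) ?_ ?_
  · have h : IntervalIntegrable (fun t : ℝ => (1 + t) ^ β) volume (-1) 0 := by
      have := (intervalIntegral.intervalIntegrable_rpow' (a := 0) (b := 1) hβ).comp_add_left 1
      simpa using this
    refine h.continuousOn_mul (g := fun t : ℝ => (1 - t) ^ α) fun t ht => ?_
    rw [Set.uIcc_of_le (by norm_num)] at ht
    exact (ContinuousAt.rpow_const (by fun_prop)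
      (Or.inl (by linarith [ht.2]))).continuousWithinAt
  · have h : IntervalIntegrable (fun t : ℝ => (1 - t) ^ α) volume 0 1 := by
      have := (intervalIntegral.intervalIntegrable_rpow' (a := 1) (b := 0) hα).comp_sub_left 1
      simpa using this
    refine h.mul_continuousOn (g := fun t : ℝ => (1 + t) ^ β) fun t ht => ?_
    rw [Set.uIcc_of_le (by norm_num)] at ht
    exact (ContinuousAt.rpow_const (by fun_prop)
      (Or.inl (by linarith [ht.1]))).continuousWithinAt

theorem intervalIntegrable_mul_jacWeight {α β : ℝ} (hα : -1 < α) (hβ : -1 < β) {f : ℝ → ℝ}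
    (hf : Continuous f) :
    IntervalIntegrable (fun t => f t * jacWeight α β t) volume (-1) 1 :=
  (intervalIntegrable_jacWeight hα hβ).continuousOn_mul hf.continuousOn

theorem integral_jacWeight_pos {α β : ℝ} (hα : -1 < α) (hβ : -1 < β) :
    0 < ∫ t in (-1 : ℝ)..1, jacWeight α β t :=
  intervalIntegral.intervalIntegral_pos_of_pos_on (intervalIntegrable_jacWeight hα hβ)
    (fun _ ht => jacWeight_pos α β ht.1 ht.2) (by norm_num)

/-- The functional `p ↦ ∫ p w*` on polynomials. -/
def jacInt {α β : ℝ} (hα : -1 < α) (hβ : -1 < β) : ℝ[X] →ₗ[ℝ] ℝ where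
  toFun p := jacMean α β fun t => p.eval t
  map_add' p q := by
    simp only [jacMean, eval_add, add_mul]
    rw [intervalIntegral.integral_add (intervalIntegrable_mul_jacWeight hα hβ p.continuous)
      (intervalIntegrable_mul_jacWeight hα hβ q.continuous), add_div]
  map_smul' c p := by
    simp only [jacMean, eval_smul, smul_eq_mul, mul_assoc, RingHom.id_apply]
    rw [intervalIntegral.integral_const_mul, mul_div_assoc]

section
variable {α β : ℝ} (hα : -1 < α) (hβ : -1 < β)
include hα hβ

theorem jacMean_eval (p : ℝ[X]) : jacMean α β (fun t => p.eval t) = jacInt hα hβ p := rfl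

/-- The zeros of `p` form a finite, hence null, set, so the integrand is positive almost everywhere.
-/
theorem jacInt_pos {p : ℝ[X]} (hp : p ≠ 0) (h : ∀ t, -1 < t → t < 1 → 0 ≤ p.eval t) :
    0 < jacInt hα hβ p := by
  rw [← jacMean_eval]
  refine div_pos ?_ (integral_jacWeight_pos hα hβ)
  rw [intervalIntegral.integral_of_le (by norm_num), integral_Ioc_eq_integral_Ioo,
    setIntegral_pos_iff_support_of_nonneg_ae]
  · have hsub : Set.Ioo (-1 : ℝ) 1 \ (p.roots.toFinset : Set ℝ) ⊆
        Function.support (fun t => p.eval t * jacWeight α β t) ∩ Set.Ioo (-1) 1 := by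
      rintro t ⟨ht, hr⟩
      refine ⟨mul_ne_zero (fun h0 => hr ?_) (jacWeight_pos α β ht.1 ht.2).ne', ht⟩
      simpa [hp] using h0
    refine lt_of_lt_of_le ?_ (measure_mono hsub)
    rw [measure_sdiff_null (Finset.measure_zero _ _)]
    simp
  · filter_upwards [ae_restrict_mem measurableSet_Ioo] with t ht
    exact mul_nonneg (h t ht.1 ht.2) (jacWeight_pos α β ht.1 ht.2).le
  · exact ((intervalIntegrable_mul_jacWeight hα hβ p.continuous).1).mono_set
      Set.Ioo_subset_Ioc_self

theorem jacInt_sq_pos {p : ℝ[X]} (hp : p ≠ 0) : 0 < jacInt hα hβ (p ^ 2) :=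
  jacInt_pos hα hβ (pow_ne_zero _ hp) fun t _ _ => by rw [eval_pow]; positivity

/-- Multiplication by `1 + t` changes the second parameter. -/
theorem jacInt_one_add_mul (hβ' : -1 < β + 1) (p : ℝ[X]) :
    jacInt hα hβ ((1 + X) * p) = jacInt hα hβ (1 + X) * jacInt hα hβ' p := by
  have key : ∀ f : ℝ → ℝ, ∫ t in (-1 : ℝ)..1, f t * jacWeight α (β + 1) t =
      ∫ t in (-1 : ℝ)..1, ((1 + t) * f t) * jacWeight α β t := by
    intro f
    rw [intervalIntegral.integral_of_le (by norm_num), intervalIntegral.integral_of_le (by norm_num)]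
    refine setIntegral_congr_fun measurableSet_Ioc fun t ht => ?_
    simp only [jacWeight]
    rw [Real.rpow_add_one (by linarith [ht.1])]
    ring
  have h1 := key fun t => p.eval t
  have h2 := key fun _ => 1
  simp only [one_mul, mul_one] at h2
  have h3 := integral_jacWeight_pos hα hβ'
  rw [← jacMean_eval, ← jacMean_eval, ← jacMean_eval]
  simp only [jacMean, eval_mul, eval_add, eval_one, eval_X, ← h1, ← h2]
  field_simp

/-- Multiplication by `1 - t` changes the first parameter. -/
theorem jacInt_one_sub_mul (hα' : -1 < α + 1) (p : ℝ[X]) :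
    jacInt hα hβ ((1 - X) * p) = jacInt hα hβ (1 - X) * jacInt hα' hβ p := by
  have key : ∀ f : ℝ → ℝ, ∫ t in (-1 : ℝ)..1, f t * jacWeight (α + 1) β t =
      ∫ t in (-1 : ℝ)..1, ((1 - t) * f t) * jacWeight α β t := by
    intro f
    rw [intervalIntegral.integral_of_le (by norm_num), intervalIntegral.integral_of_le (by norm_num),
      integral_Ioc_eq_integral_Ioo, integral_Ioc_eq_integral_Ioo]
    refine setIntegral_congr_fun measurableSet_Ioo fun t ht => ?_
    simp only [jacWeight]
    rw [Real.rpow_add_one (by linarith [ht.2])]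
    ring
  have h1 := key fun t => p.eval t
  have h2 := key fun _ => 1
  simp only [one_mul, mul_one] at h2
  have h3 := integral_jacWeight_pos hα' hβ
  rw [← jacMean_eval, ← jacMean_eval, ← jacMean_eval]
  simp only [jacMean, eval_mul, eval_sub, eval_one, eval_X, ← h1, ← h2]
  field_simp

/-! ### Orthogonal polynomials -/

omit hα hβ in
theorem jacMonic_monic_natDegree (α β : ℝ) (n : ℕ) :
    (jacMonic α β n).Monic ∧ (jacMonic α β n).natDegree = n := by
  induction n using Nat.strong_induction_on with
  | _ n ih =>
    have hlt : (∑ k : Fin n,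
        C (jacMean α β (fun t => t ^ n * (jacMonic α β k).eval t) /
          jacMean α β (fun t => ((jacMonic α β k).eval t) ^ 2)) * jacMonic α β k).degree <
        (X ^ n : ℝ[X]).degree := by
      rw [degree_X_pow]
      refine (degree_sum_le _ _).trans_lt ?_
      refine (Finset.sup_lt_iff (WithBot.bot_lt_coe n)).2 fun k _ => ?_
      rw [← smul_eq_C_mul]
      refine (degree_smul_le _ _).trans_lt ?_
      rw [degree_eq_natDegree (ih k k.2).1.ne_zero, (ih k k.2).2]
      exact WithBot.coe_lt_coe.2 k.2
    rw [jacMonic]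
    exact ⟨(monic_X_pow n).sub_of_left hlt, natDegree_eq_of_degree_eq_some (by
      rw [degree_sub_eq_left_of_degree_lt hlt, degree_X_pow])⟩

end

theorem jacMonic_monic (α β : ℝ) (n : ℕ) : (jacMonic α β n).Monic :=
  (jacMonic_monic_natDegree α β n).1

theorem natDegree_jacMonic (α β : ℝ) (n : ℕ) : (jacMonic α β n).natDegree = n :=
  (jacMonic_monic_natDegree α β n).2

section
variable {α β : ℝ} (hα : -1 < α) (hβ : -1 < β)
include hα hβ

theorem jacMonic_eq (n : ℕ) : jacMonic α β n = X ^ n - ∑ k : Fin n,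
    C (jacInt hα hβ (X ^ n * jacMonic α β k) / jacInt hα hβ (jacMonic α β k ^ 2)) *
      jacMonic α β k := by
  rw [jacMonic]
  simp only [← jacMean_eval, eval_mul, eval_pow, eval_X]

theorem jacInt_C_mul (c : ℝ) (p : ℝ[X]) : jacInt hα hβ (C c * p) = c * jacInt hα hβ p := by
  rw [← smul_eq_C_mul, map_smul, smul_eq_mul]

/-- Gram-Schmidt: the `j`-th subtracted term is the projection that cancels `X ^ n`, and the others
vanish by induction. -/
theorem jacInt_jacMonic_mul_jacMonic {n j : ℕ} (hj : j < n) :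
    jacInt hα hβ (jacMonic α β n * jacMonic α β j) = 0 := by
  induction n using Nat.strong_induction_on generalizing j with
  | _ n ih =>
    rw [jacMonic_eq hα hβ n, sub_mul, map_sub, Finset.sum_mul, map_sum,
      Finset.sum_eq_single ⟨j, hj⟩]
    · rw [mul_assoc, jacInt_C_mul, ← sq, div_mul_cancel₀, sub_self]
      exact (jacInt_sq_pos hα hβ (jacMonic_monic α β j).ne_zero).ne'
    · intro k _ hk
      rw [mul_assoc, jacInt_C_mul]
      rcases lt_or_gt_of_ne (fun h => hk (Fin.ext h) : (k : ℕ) ≠ j) with h | h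
      · rw [mul_comm (jacMonic α β k), ih j hj h, mul_zero]
      · rw [ih k k.2 h, mul_zero]
    · simp

theorem jacInt_jacMonic_mul {n : ℕ} {p : ℝ[X]} (hp : p.degree < n) :
    jacInt hα hβ (jacMonic α β n * p) = 0 := by
  suffices H : ∀ d ≤ n, ∀ p : ℝ[X], p.degree < d → jacInt hα hβ (jacMonic α β n * p) = 0 from
    H n le_rfl p hp
  intro d
  induction d with
  | zero =>
    intro _ p hp
    have : p = 0 := by simpa using hp
    simp [this]
  | succ d ih =>
    intro hd p hp
    have hM := jacMonic_monic α β d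
    have hlt : (p - C (p.coeff d) * jacMonic α β d).degree < (d : WithBot ℕ) := by
      rw [degree_lt_iff_coeff_zero]
      intro k hk
      rw [coeff_sub, coeff_C_mul]
      rcases hk.eq_or_lt with rfl | hk
      · have := hM.coeff_natDegree
        rw [natDegree_jacMonic] at this
        rw [this, mul_one, sub_self]
      · rw [coeff_eq_zero_of_degree_lt (hp.trans_le (by exact_mod_cast hk)),
          coeff_eq_zero_of_natDegree_lt (p := jacMonic α β d) (by rwa [natDegree_jacMonic]),
          mul_zero, sub_zero]
    have h1 := ih (by lia) _ hlt
    rw [mul_sub, map_sub, mul_left_comm, jacInt_C_mul,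
      jacInt_jacMonic_mul_jacMonic hα hβ (by lia : d < n), mul_zero, sub_zero] at h1
    exact h1

theorem jacNormSq_pos (n : ℕ) : 0 < jacMean α β (fun t => ((jacMonic α β n).eval t) ^ 2) := by
  simpa only [← jacMean_eval, eval_pow] using
    jacInt_sq_pos hα hβ (jacMonic_monic α β n).ne_zero

theorem jac_scale_pos (n : ℕ) :
    0 < (Real.sqrt (jacMean α β (fun t => ((jacMonic α β n).eval t) ^ 2)))⁻¹ :=
  inv_pos.2 (Real.sqrt_pos.2 (jacNormSq_pos hα hβ n))

theorem natDegree_jac (n : ℕ) : (jac α β n).natDegree = n := by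
  rw [jac, natDegree_C_mul (jac_scale_pos hα hβ n).ne', natDegree_jacMonic]

theorem jac_ne_zero (n : ℕ) : jac α β n ≠ 0 :=
  mul_ne_zero (C_ne_zero.2 (jac_scale_pos hα hβ n).ne') (jacMonic_monic α β n).ne_zero

theorem jacInt_jac_mul {n : ℕ} {p : ℝ[X]} (hp : p.degree < n) :
    jacInt hα hβ (jac α β n * p) = 0 := by
  rw [jac, mul_assoc, jacInt_C_mul, jacInt_jacMonic_mul hα hβ hp, mul_zero]

theorem jacInt_jac_mul_jac (n k : ℕ) :
    jacInt hα hβ (jac α β n * jac α β k) = if n = k then 1 else 0 := by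
  have hdeg : ∀ i, (jac α β i).degree = i := fun i => by
    rw [degree_eq_natDegree (jac_ne_zero hα hβ i), natDegree_jac hα hβ]
  rcases lt_trichotomy n k with h | rfl | h
  · rw [mul_comm, jacInt_jac_mul hα hβ (by rw [hdeg]; exact_mod_cast h), if_neg h.ne]
  · have h0 := jacNormSq_pos hα hβ n
    have h1 : jacInt hα hβ (jacMonic α β n * jacMonic α β n) =
        jacMean α β (fun t => ((jacMonic α β n).eval t) ^ 2) := by
      rw [← jacMean_eval]; simp only [eval_mul, sq]
    rw [if_pos rfl, jac, mul_assoc, jacInt_C_mul, mul_left_comm, jacInt_C_mul, h1, ← mul_assoc,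
      ← mul_inv, Real.mul_self_sqrt h0.le, inv_mul_cancel₀ h0.ne']
  · rw [jacInt_jac_mul hα hβ (by rw [hdeg]; exact_mod_cast h), if_neg h.ne']

/-! ### The zeros of the orthogonal polynomials -/

/-- A factor of constant sign on `(-1,1)` of an orthogonal polynomial is a constant. -/
theorem natDegree_eq_zero_of_mul_eq_jac {n : ℕ} {d e : ℝ[X]} (h : d * e = jac α β n)
    (hd : ∀ t, -1 < t → t < 1 → 0 ≤ d.eval t) : d.natDegree = 0 := by
  by_contra hd0
  have hne : d * e ≠ 0 := h ▸ jac_ne_zero hα hβ n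
  have hdn := left_ne_zero_of_mul hne
  have hen := right_ne_zero_of_mul hne
  have hdeg : d.natDegree + e.natDegree = n := by
    rw [← natDegree_mul hdn hen, h, natDegree_jac hα hβ]
  -- If `d` were not constant, then `deg e < n`, and orthogonality would contradict the positivity
  -- of the integral of `d e^2`.
  have h0 : jacInt hα hβ (jac α β n * e) = 0 :=
    jacInt_jac_mul hα hβ (by rw [degree_eq_natDegree hen]; exact_mod_cast (by lia))
  refine (jacInt_pos hα hβ (p := jac α β n * e) ?_ ?_).ne' h0
  · rw [← h]; exact mul_ne_zero hne hen
  · intro t h1 h2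
    rw [← h, mul_assoc, eval_mul, eval_mul]
    exact mul_nonneg (hd t h1 h2) (mul_self_nonneg _)

/-- By the intermediate value theorem a factor without zeros in the interval has constant sign
there. -/
theorem natDegree_eq_zero_of_dvd_jac {n : ℕ} {d : ℝ[X]} (h : d ∣ jac α β n)
    (hd : ∀ t, -1 < t → t < 1 → d.eval t ≠ 0) : d.natDegree = 0 := by
  obtain ⟨e, he⟩ := h
  have hpre : IsPreconnected (Set.Ioo (-1 : ℝ) 1) := isPreconnected_Ioo
  rcases lt_or_gt_of_ne (hd 0 (by norm_num) (by norm_num)) with h0 | h0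
  · rw [← natDegree_neg]
    refine natDegree_eq_zero_of_mul_eq_jac hα hβ (e := -e) (by rw [neg_mul_neg, he]) ?_
    intro t h1 h2
    by_contra! hlt
    rw [eval_neg, neg_lt_zero] at hlt
    obtain ⟨s, hs, hs0⟩ := hpre.intermediate_value (a := 0) (b := t) ⟨by norm_num, by norm_num⟩
      ⟨h1, h2⟩ d.continuous.continuousOn ⟨h0.le, hlt.le⟩
    exact hd s hs.1 hs.2 hs0
  · refine natDegree_eq_zero_of_mul_eq_jac hα hβ he.symm ?_
    intro t h1 h2
    by_contra! hlt
    obtain ⟨s, hs, hs0⟩ := hpre.intermediate_value (a := t) (b := 0) ⟨h1, h2⟩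
      ⟨by norm_num, by norm_num⟩ d.continuous.continuousOn ⟨hlt.le, h0.le⟩
    exact hd s hs.1 hs.2 hs0

theorem mem_Ioo_of_mem_roots_jac {n : ℕ} {r : ℝ} (hr : r ∈ (jac α β n).roots) :
    -1 < r ∧ r < 1 := by
  by_contra hn
  have h := natDegree_eq_zero_of_dvd_jac hα hβ (dvd_iff_isRoot.2 (isRoot_of_mem_roots hr))
    fun t h1 h2 h0 => hn (by
      rw [eval_sub, eval_X, eval_C, sub_eq_zero] at h0
      exact h0 ▸ ⟨h1, h2⟩)
  rw [natDegree_X_sub_C] at h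
  exact one_ne_zero h

/-- Dividing out all linear factors leaves a factor without real zeros, which is constant. -/
theorem card_roots_jac (n : ℕ) : (jac α β n).roots.card = n := by
  obtain ⟨q, hq, hcard, hroots⟩ := exists_prod_multiset_X_sub_C_mul (jac α β n)
  have hdvd : q ∣ jac α β n := ⟨_, by rw [mul_comm, hq]⟩
  have hq0 : q ≠ 0 := ne_zero_of_dvd_ne_zero (jac_ne_zero hα hβ n) hdvd
  have h0 := natDegree_eq_zero_of_dvd_jac hα hβ hdvd fun t _ _ ht => by
    have : t ∈ q.roots := (mem_roots hq0).2 ht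
    simp [hroots] at this
  rw [natDegree_jac hα hβ] at hcard
  lia

/-- A multiple root would give the nonconstant, nonnegative factor `(X - r)^2`. -/
theorem nodup_roots_jac (n : ℕ) : (jac α β n).roots.Nodup := by
  rw [Multiset.nodup_iff_count_le_one]
  intro r
  rw [count_roots]
  by_contra! h
  obtain ⟨e, he⟩ := (pow_dvd_pow (X - C r) (show 2 ≤ _ from h)).trans (pow_rootMultiplicity_dvd (jac α β n) r)
  have h2 := natDegree_eq_zero_of_mul_eq_jac hα hβ he.symm fun t _ _ => by
    rw [eval_pow]; positivity
  rw [natDegree_pow, natDegree_X_sub_C] at h2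
  simp at h2

end

/-! ### The Gauss-Radau rule -/

section
variable {α β : ℝ} (hα : -1 < α) (hβ : -1 < β)

theorem radauNode_zero (α β : ℝ) (m : ℕ) : radauNode α β m 0 = 1 := rfl

include hα hβ

omit hβ in
theorem neg_one_lt_add_one : -1 < α + 1 := by linarith

theorem length_sort_roots_jac (m : ℕ) :
    ((jac (α + 1) β m).roots.sort (· ≥ ·)).length = m := by
  rw [Multiset.length_sort, card_roots_jac (neg_one_lt_add_one hα) hβ]

theorem radauNode_succ_eq {m k : ℕ} (hk : k < m) : radauNode α β m (k + 1) =
    ((jac (α + 1) β m).roots.sort (· ≥ ·))[k]'(by rwa [length_sort_roots_jac hα hβ]) := by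
  rw [radauNode, List.getD_cons_succ, List.getD_eq_getElem]

theorem radauNode_succ_mem_roots {m k : ℕ} (hk : k < m) :
    radauNode α β m (k + 1) ∈ (jac (α + 1) β m).roots := by
  rw [radauNode_succ_eq hα hβ hk, ← Multiset.mem_sort (r := (· ≥ ·))]
  exact List.getElem_mem _

theorem exists_radauNode_eq {m : ℕ} {r : ℝ} (hr : r ∈ (jac (α + 1) β m).roots) :
    ∃ k < m, radauNode α β m (k + 1) = r := by
  rw [← Multiset.mem_sort (r := (· ≥ ·))] at hr
  obtain ⟨k, hk, h⟩ := List.getElem_of_mem hr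
  have hk' : k < m := by rwa [length_sort_roots_jac hα hβ] at hk
  exact ⟨k, hk', by rw [radauNode_succ_eq hα hβ hk', h]⟩

theorem radauNode_mem {m k : ℕ} (hk : k ≤ m) :
    -1 < radauNode α β m k ∧ radauNode α β m k ≤ 1 := by
  rcases k with _ | k
  · rw [radauNode_zero]; norm_num
  · have := mem_Ioo_of_mem_roots_jac (neg_one_lt_add_one hα) hβ
      (radauNode_succ_mem_roots hα hβ (show k < m by lia))
    exact ⟨this.1, this.2.le⟩

theorem radauNode_succ_lt_one {m k : ℕ} (hk : k < m) : radauNode α β m (k + 1) < 1 :=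
  (mem_Ioo_of_mem_roots_jac (neg_one_lt_add_one hα) hβ (radauNode_succ_mem_roots hα hβ hk)).2

theorem radauNode_injOn (m : ℕ) :
    Set.InjOn (radauNode α β m) (Finset.range (m + 1) : Set ℕ) := by
  intro i hi j hj h
  simp only [Finset.coe_range, Set.mem_Iio] at hi hj
  rcases i with _ | i <;> rcases j with _ | j
  · rfl
  · exact absurd h.symm (radauNode_succ_lt_one hα hβ (by lia)).ne
  · exact absurd h (radauNode_succ_lt_one hα hβ (by lia)).ne
  · rw [radauNode_succ_eq hα hβ (by lia), radauNode_succ_eq hα hβ (by lia)] at h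
    have hnd : ((jac (α + 1) β m).roots.sort (· ≥ ·)).Nodup := by
      rw [← Multiset.coe_nodup, Multiset.sort_eq]
      exact nodup_roots_jac (neg_one_lt_add_one hα) hβ m
    rw [hnd.getElem_inj_iff.1 h]

theorem radauCoeff_eq (m k : ℕ) : radauCoeff α β m k =
    jacInt hα hβ (Lagrange.basis (Finset.range (m + 1)) (radauNode α β m) k) := rfl

/-- The Gauss-Radau rule is exact for polynomials of degree at most `2 m`. -/
theorem jacInt_eq_radau {m : ℕ} {f : ℝ[X]} (hf : f.natDegree ≤ 2 * m) :
    jacInt hα hβ f =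
      ∑ k ∈ Finset.range (m + 1), radauCoeff α β m k * f.eval (radauNode α β m k) := by
  have hα' := neg_one_lt_add_one hα
  have hinj := radauNode_injOn hα hβ m
  set L := Lagrange.interpolate (Finset.range (m + 1)) (radauNode α β m)
    (fun k => f.eval (radauNode α β m k)) with hL
  have hLint : jacInt hα hβ L =
      ∑ k ∈ Finset.range (m + 1), radauCoeff α β m k * f.eval (radauNode α β m k) := by
    rw [hL, Lagrange.interpolate_apply, map_sum]
    refine Finset.sum_congr rfl fun k _ => ?_
    rw [jacInt_C_mul, ← radauCoeff_eq, mul_comm]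
  have hLdeg : L.natDegree ≤ m := by
    have := Lagrange.degree_interpolate_lt (fun k => f.eval (radauNode α β m k)) hinj
    rw [Finset.card_range, ← hL] at this
    exact natDegree_le_iff_degree_le.2 (Order.le_of_lt_succ (by exact_mod_cast this))
  have hzero : ∀ k ≤ m, (f - L).eval (radauNode α β m k) = 0 := by
    intro k hk
    rw [eval_sub, hL, Lagrange.eval_interpolate_at_node _ hinj (by simp; lia), sub_self]
  rw [← hLint, ← sub_eq_zero, ← map_sub]
  by_cases hp : f - L = 0
  · rw [hp, map_zero]
  -- The error `f - L` vanishes at `1` and at all zeros of `p_m^{(α+1,β)}`, so it is `(X - 1)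
  -- p_m^{(α+1,β)} e`; the degree bound on `f` leaves `deg e < m`.
  obtain ⟨g, hg⟩ : (X - C 1) ∣ f - L := dvd_iff_isRoot.2 (hzero 0 (Nat.zero_le _))
  have hg0 : g ≠ 0 := by rintro rfl; simp [hg] at hp
  have hle : (jac (α + 1) β m).roots ≤ g.roots := by
    rw [Multiset.le_iff_subset (nodup_roots_jac hα' hβ m)]
    intro r hr
    rw [mem_roots hg0]
    obtain ⟨k, hk, rfl⟩ := exists_radauNode_eq hα hβ hr
    have h0 := hzero (k + 1) (by lia)
    rw [hg, eval_mul, eval_sub, eval_X, eval_C] at h0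
    exact (mul_eq_zero.1 h0).resolve_left
      (sub_ne_zero.2 (radauNode_succ_lt_one hα hβ hk).ne)
  obtain ⟨e, he⟩ : jac (α + 1) β m ∣ g := by
    rw [← C_leadingCoeff_mul_prod_multiset_X_sub_C (p := jac (α + 1) β m)
      (by rw [card_roots_jac hα' hβ, natDegree_jac hα' hβ])]
    refine (IsUnit.mul_left_dvd (isUnit_C.2
      (leadingCoeff_ne_zero.2 (jac_ne_zero hα' hβ m)).isUnit)).2 ?_
    exact (Multiset.prod_X_sub_C_dvd_iff_le_roots hg0 _).2 hle
  have he0 : e ≠ 0 := by rintro rfl; simp [he] at hg0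
  have hdeg : (f - L).natDegree = 1 + (m + e.natDegree) := by
    rw [hg, natDegree_mul (X_sub_C_ne_zero 1) hg0, natDegree_X_sub_C, he,
      natDegree_mul (jac_ne_zero hα' hβ m) he0, natDegree_jac hα' hβ]
  have hdeg' : (f - L).natDegree ≤ 2 * m :=
    (natDegree_sub_le _ _).trans (max_le hf (by lia))
  -- The factor `1 - X` passes into the weight, where `p_m^{(α+1,β)}` is orthogonal to `e`.
  rw [hg, he, show (X - C 1 : ℝ[X]) * (jac (α + 1) β m * e) =
    -((1 - X) * (jac (α + 1) β m * e)) by rw [C_1]; ring, map_neg, jacInt_one_sub_mul hα hβ hα',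
    jacInt_jac_mul hα' hβ, mul_zero, neg_zero]
  rw [degree_eq_natDegree he0]
  exact_mod_cast (by lia)

/-- The square of a Lagrange basis polynomial has degree `2m`, so the rule is exact for it and
returns just `μ_k`. -/
theorem radauCoeff_pos {m k : ℕ} (hk : k ≤ m) : 0 < radauCoeff α β m k := by
  have hinj := radauNode_injOn hα hβ m
  have hk' : k ∈ Finset.range (m + 1) := by simp; lia
  set b := Lagrange.basis (Finset.range (m + 1)) (radauNode α β m) k with hb
  have hbdeg : b.natDegree = m := by
    rw [natDegree_eq_of_degree_eq_some (Lagrange.degree_basis hinj hk'), Finset.card_range]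
    rfl
  have hb0 : b ≠ 0 := Lagrange.basis_ne_zero hinj hk'
  have h := jacInt_eq_radau hα hβ (m := m) (f := b ^ 2) (by rw [natDegree_pow, hbdeg])
  rw [Finset.sum_eq_single k] at h
  · rw [eval_pow, hb, Lagrange.eval_basis_self hinj hk', one_pow, mul_one] at h
    rw [← h]
    exact jacInt_sq_pos hα hβ hb0
  · intro j hj hjk
    rw [eval_pow, hb, Lagrange.eval_basis_of_ne hjk.symm hj]
    ring
  · exact fun h => absurd hk' h

/-- Up to degree `2 m - 1` the discrete functional with weights `μ_k (1 + x_k)` is a multiple of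
the one of the Jacobi weight with parameters `α`, `β + 1`. -/
theorem radau_one_add_mul {m : ℕ} (hβ' : -1 < β + 1) {f : ℝ[X]} (hf : f.natDegree + 1 ≤ 2 * m) :
    ∑ k ∈ Finset.range (m + 1), radauCoeff α β m k * (1 + radauNode α β m k) *
      f.eval (radauNode α β m k) = jacInt hα hβ (1 + X) * jacInt hα hβ' f := by
  rw [← jacInt_one_add_mul, jacInt_eq_radau hα hβ (m := m)]
  · simp only [eval_mul, eval_add, eval_one, eval_X, mul_assoc]
  · refine natDegree_mul_le.trans ?_
    have : (1 + X : ℝ[X]).natDegree ≤ 1 := by rw [add_comm]; exact natDegree_X_add_C (1 : ℝ) |>.le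
    lia

/-- For `l < m` the polynomial `(1 + x) p_l^2` has degree `2l + 1 ≤ 2m`, and the value does not
depend on `l`. For `l = m` the degree `2m + 1` exceeds the exactness of the rule, which is why `ĥ_m`
is treated separately. -/
theorem hHat_eq {m l : ℕ} (hl : l < m) : hHat α β m l = jacInt hα hβ (1 + X) := by
  have hβ' := neg_one_lt_add_one hβ
  have h := radau_one_add_mul hα hβ hβ' (m := m) (f := jac α (β + 1) l * jac α (β + 1) l)
    (by rw [natDegree_mul (jac_ne_zero hα hβ' l) (jac_ne_zero hα hβ' l), natDegree_jac hα hβ']; lia)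
  rw [jacInt_jac_mul_jac, if_pos rfl, mul_one] at h
  rw [← h, hHat]
  simp only [eval_mul, sq]

/-- All weights are positive, and a nonzero polynomial of degree at most `m` cannot vanish at `m +
1` distinct nodes. -/
theorem hHat_pos {m l : ℕ} (hl : l ≤ m) : 0 < hHat α β m l := by
  have hβ' := neg_one_lt_add_one hβ
  have hpos : ∀ k ∈ Finset.range (m + 1),
      0 < radauCoeff α β m k * (1 + radauNode α β m k) := fun k hk => by
    have hk' : k ≤ m := by simp at hk; lia
    exact mul_pos (radauCoeff_pos hα hβ hk') (by linarith [(radauNode_mem hα hβ hk').1])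
  refine Finset.sum_pos' (fun k hk => mul_nonneg (hpos k hk).le (sq_nonneg _)) ?_
  by_contra! hcon
  refine jac_ne_zero hα hβ' l ?_
  refine eq_zero_of_degree_lt_of_eval_index_eq_zero (Finset.range (m + 1))
    (radauNode_injOn hα hβ m) ?_ fun k hk => ?_
  · rw [degree_eq_natDegree (jac_ne_zero hα hβ' l), natDegree_jac hα hβ', Finset.card_range]
    exact_mod_cast Nat.lt_succ_of_le hl
  · by_contra hne
    exact absurd (hcon k hk) (not_le.2 (mul_pos (hpos k hk) (by positivity)))

/-- Discrete orthogonality of the polynomials `p_l^{(α,β+1)}`. -/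
theorem radau_jac_mul_jac {m k l : ℕ} (hk : k ≤ m) (hl : l ≤ m) :
    ∑ i ∈ Finset.range (m + 1), radauCoeff α β m i * (1 + radauNode α β m i) *
      ((jac α (β + 1) k).eval (radauNode α β m i) * (jac α (β + 1) l).eval (radauNode α β m i)) =
      if k = l then hHat α β m k else 0 := by
  have hβ' := neg_one_lt_add_one hβ
  split_ifs with h
  · subst h; simp only [hHat, sq]
  -- Distinct indices up to `m` have sum at most `2m - 1`, just within the exactness range.
  · have h1 := radau_one_add_mul hα hβ hβ' (m := m) (f := jac α (β + 1) k * jac α (β + 1) l)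
      (by rw [natDegree_mul (jac_ne_zero hα hβ' k) (jac_ne_zero hα hβ' l),
        natDegree_jac hα hβ', natDegree_jac hα hβ']; lia)
    rw [jacInt_jac_mul_jac, if_neg h, mul_zero] at h1
    simpa only [eval_mul] using h1

/-- Discrete orthogonality of `p_m^{(α,β+1)}` to the polynomials of smaller degree. -/
theorem radau_jac_mul_of_lt {m : ℕ} {f : ℝ[X]} {k : ℕ} (hk : k ≤ m) (hf : f.degree < k) :
    ∑ i ∈ Finset.range (m + 1), radauCoeff α β m i * (1 + radauNode α β m i) *
      ((jac α (β + 1) k).eval (radauNode α β m i) * f.eval (radauNode α β m i)) = 0 := by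
  have hβ' := neg_one_lt_add_one hβ
  by_cases hf0 : f = 0
  · simp [hf0]
  rw [degree_eq_natDegree hf0] at hf
  have hf' : f.natDegree < k := by exact_mod_cast hf
  have h1 := radau_one_add_mul hα hβ hβ' (m := m) (f := jac α (β + 1) k * f)
    (by rw [natDegree_mul (jac_ne_zero hα hβ' k) hf0, natDegree_jac hα hβ']; lia)
  rw [jacInt_jac_mul hα hβ' (by rwa [degree_eq_natDegree hf0]), mul_zero] at h1
  simpa only [eval_mul] using h1

end

/-! ### Two-dimensional integrals -/

/-- If `S` is, up to a null set, the disjoint union of `A` and its mirror image, then the integral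
over `S` of a symmetric function is twice the integral over `A`. -/
theorem setIntegral_eq_two_mul_of_symm {E : Type*} [MeasurableSpace E] {μ : Measure E}
    {σ : E → E} (hσ : MeasurePreserving σ μ μ) (hσe : MeasurableEmbedding σ) {A S : Set E}
    (hA : MeasurableSet A) (hd : Disjoint A (σ ⁻¹' A)) (hS : S =ᵐ[μ] (A ∪ σ ⁻¹' A : Set E))
    {G : E → ℝ} (hG : ∀ p, G (σ p) = G p) :
    (IntegrableOn G S μ ↔ IntegrableOn G A μ) ∧ ∫ p in S, G p ∂μ = 2 * ∫ p in A, G p ∂μ := by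
  have hGσ : G ∘ σ = G := funext hG
  have h1 : IntegrableOn G (σ ⁻¹' A) μ ↔ IntegrableOn G A μ := by
    conv_lhs => rw [← hGσ]
    exact hσ.integrableOn_comp_preimage hσe
  have h2 : ∫ p in σ ⁻¹' A, G p ∂μ = ∫ p in A, G p ∂μ := by
    rw [← hσ.setIntegral_preimage_emb hσe G A]
    simp only [hG]
  have h3 : IntegrableOn G S μ ↔ IntegrableOn G A μ := by
    rw [integrableOn_congr_set_ae hS, integrableOn_union, h1, and_self_iff]
  refine ⟨h3, ?_⟩
  by_cases hi : IntegrableOn G A μ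
  · rw [setIntegral_congr_set hS, setIntegral_union hd (hσ.measurable hA) hi (h1.2 hi), h2, two_mul]
  -- Without integrability both integrals have the default value `0`, so no such hypothesis is
  -- needed.
  · rw [integral_undef hi, integral_undef (fun h => hi (h3.1 h)), mul_zero]

theorem volume_line_eq_zero (c : ℝ) : volume {p : ℝ × ℝ | p.2 = c * p.1} = 0 := by
  have hm : MeasurableSet {p : ℝ × ℝ | p.2 = c * p.1} :=
    (isClosed_eq continuous_snd (continuous_const.mul continuous_fst)).measurableSet
  rw [Measure.volume_eq_prod, Measure.measure_prod_null hm]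
  refine Filter.Eventually.of_forall fun x => ?_
  have : Prod.mk x ⁻¹' {p : ℝ × ℝ | p.2 = c * p.1} = {c * x} := by ext y; simp
  simp only [this, measure_singleton, Pi.zero_apply]

/-- Lets the two diagonals be discarded when the square is cut along them. -/
theorem ae_eq_of_subset_line {S T : Set (ℝ × ℝ)} (c : ℝ) (h : T ⊆ S)
    (h' : ∀ p ∈ S, p ∉ T → p.2 = c * p.1) : S =ᵐ[volume] T := by
  refine (Filter.EventuallyLE.antisymm (LE.le.eventuallyLE h) ?_).symm
  rw [ae_le_set]
  exact measure_mono_null (fun p hp => h' p hp.1 hp.2) (volume_line_eq_zero c)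

/-- The open square. -/
def openSquare : Set (ℝ × ℝ) := Set.Ioo (-1) 1 ×ˢ Set.Ioo (-1) 1

/-- The lower half of the open square. -/
def lowerHalf : Set (ℝ × ℝ) := {p | p ∈ openSquare ∧ p.2 < p.1}

/-- The right quarter of the open square. -/
def rightQuarter : Set (ℝ × ℝ) := {p | p ∈ lowerHalf ∧ -p.2 < p.1}

theorem isOpen_openSquare : IsOpen openSquare := isOpen_Ioo.prod isOpen_Ioo

theorem measurableSet_lowerHalf : MeasurableSet lowerHalf :=
  (isOpen_openSquare.inter (isOpen_lt continuous_snd continuous_fst)).measurableSet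

theorem measurableSet_rightQuarter : MeasurableSet rightQuarter :=
  measurableSet_lowerHalf.inter (isOpen_lt continuous_snd.neg continuous_fst).measurableSet

theorem square_ae_eq : square =ᵐ[volume] openSquare :=
  (Measure.set_prod_ae_eq Ioo_ae_eq_Icc Ioo_ae_eq_Icc).symm

theorem measurePreserving_prodSwap :
    MeasurePreserving (Prod.swap : ℝ × ℝ → ℝ × ℝ) volume volume :=
  Measure.measurePreserving_swap

theorem measurableEmbedding_prodSwap : MeasurableEmbedding (Prod.swap : ℝ × ℝ → ℝ × ℝ) :=
  (MeasurableEquiv.prodComm : ℝ × ℝ ≃ᵐ ℝ × ℝ).measurableEmbedding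

theorem measurableEmbedding_prodNeg : MeasurableEmbedding (Neg.neg : ℝ × ℝ → ℝ × ℝ) :=
  (MeasurableEquiv.neg (ℝ × ℝ)).measurableEmbedding

theorem setIntegral_openSquare {G : ℝ × ℝ → ℝ} (hG : ∀ p, G p.swap = G p) :
    (IntegrableOn G openSquare ↔ IntegrableOn G lowerHalf) ∧
      ∫ p in openSquare, G p = 2 * ∫ p in lowerHalf, G p := by
  refine setIntegral_eq_two_mul_of_symm measurePreserving_prodSwap measurableEmbedding_prodSwap
    measurableSet_lowerHalf ?_ ?_ hG
  · exact Set.disjoint_left.2 fun p h h' => lt_asymm h.2 h'.2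
  · refine ae_eq_of_subset_line 1 ?_ ?_
    · rintro p (h | h)
      · exact h.1
      · exact ⟨h.1.2, h.1.1⟩
    · intro p hp hn
      by_contra hne
      rw [one_mul] at hne
      rcases lt_or_gt_of_ne hne with h | h
      · exact hn (Or.inl ⟨hp, h⟩)
      · exact hn (Or.inr ⟨⟨hp.2, hp.1⟩, h⟩)

theorem setIntegral_lowerHalf {G : ℝ × ℝ → ℝ} (hG : ∀ p, G (-p.swap) = G p) :
    (IntegrableOn G lowerHalf ↔ IntegrableOn G rightQuarter) ∧
      ∫ p in lowerHalf, G p = 2 * ∫ p in rightQuarter, G p := by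
  refine setIntegral_eq_two_mul_of_symm (σ := fun p : ℝ × ℝ => -p.swap)
    ((Measure.measurePreserving_neg (volume : Measure (ℝ × ℝ))).comp measurePreserving_prodSwap)
    (measurableEmbedding_prodNeg.comp measurableEmbedding_prodSwap)
    measurableSet_rightQuarter ?_ ?_ hG
  · refine Set.disjoint_left.2 fun p h h' => ?_
    have h1 := h.2
    have h2 : - -p.1 < -p.2 := h'.2
    linarith
  · have hmem : ∀ p ∈ lowerHalf, -p.swap ∈ lowerHalf := by
      rintro p ⟨⟨⟨h1, h2⟩, h3, h4⟩, h5⟩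
      refine ⟨⟨⟨?_, ?_⟩, ?_, ?_⟩, ?_⟩ <;> simp only [Prod.fst_neg, Prod.snd_neg, Prod.fst_swap,
        Prod.snd_swap] <;> linarith
    refine ae_eq_of_subset_line (-1) ?_ ?_
    · rintro p (h | h)
      · exact h.1
      · simpa using hmem _ h.1
    · intro p hp hn
      by_contra hne
      rcases lt_or_gt_of_ne hne with h | h
      · refine hn (Or.inr ⟨hmem p hp, ?_⟩)
        simp only [Prod.fst_neg, Prod.snd_neg, Prod.fst_swap, Prod.snd_swap]
        linarith
      · exact hn (Or.inl ⟨hp, by linarith⟩)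

/-- The linear map of the plane with matrix `!![a, b; c, d]`. -/
def planeMap (a b c d : ℝ) : ℝ × ℝ →L[ℝ] ℝ × ℝ :=
  (Matrix.toLin (.finTwoProd ℝ) (.finTwoProd ℝ) !![a, b; c, d]).toContinuousLinearMap

theorem det_planeMap (a b c d : ℝ) : (planeMap a b c d).det = a * d - b * c := by
  simp only [planeMap, LinearMap.det_toContinuousLinearMap, LinearMap.det_toLin,
    Matrix.det_fin_two_of]

/-- The map `(x, y) ↦ (x + y, x y)`. -/
def symMap (p : ℝ × ℝ) : ℝ × ℝ := (p.1 + p.2, p.1 * p.2)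

theorem continuous_symMap : Continuous symMap := by unfold symMap; fun_prop

theorem hasFDerivAt_symMap (p : ℝ × ℝ) : HasFDerivAt symMap (planeMap 1 1 p.2 p.1) p := by
  have h1 : HasFDerivAt (fun q : ℝ × ℝ => q.1) (ContinuousLinearMap.fst ℝ ℝ ℝ) p :=
    hasFDerivAt_fst
  have h2 : HasFDerivAt (fun q : ℝ × ℝ => q.2) (ContinuousLinearMap.snd ℝ ℝ ℝ) p :=
    hasFDerivAt_snd
  rw [planeMap, Matrix.toLin_finTwoProd_toContinuousLinearMap]
  convert! HasFDerivAt.prodMk (𝕜 := ℝ) (h1.add h2) (h1.mul h2) using 2 <;> simp [add_comm]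

theorem hasFDerivAt_toTri (p : ℝ × ℝ) :
    HasFDerivAt toTri (planeMap (2 * p.2) (2 * p.1) (2 * p.1) (2 * p.2)) p := by
  have h1 : HasFDerivAt (fun q : ℝ × ℝ => q.1) (ContinuousLinearMap.fst ℝ ℝ ℝ) p :=
    hasFDerivAt_fst
  have h2 : HasFDerivAt (fun q : ℝ × ℝ => q.2) (ContinuousLinearMap.snd ℝ ℝ ℝ) p :=
    hasFDerivAt_snd
  rw [planeMap, Matrix.toLin_finTwoProd_toContinuousLinearMap]
  convert! HasFDerivAt.prodMk (𝕜 := ℝ) ((h1.const_mul (2 : ℝ)).mul h2)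
    (((h1.pow 2).add (h2.pow 2)).sub_const (1 : ℝ)) using 2 <;>
  (ext <;> simp); ring

/-- The image determines `(x - y)^2 = u^2 - 4v`, and `x - y` is positive below the diagonal. -/
theorem symMap_injOn : Set.InjOn symMap lowerHalf := by
  rintro ⟨x, y⟩ ⟨-, h⟩ ⟨x', y'⟩ ⟨-, h'⟩ heq
  simp only [symMap, Prod.mk.injEq] at heq h h'
  obtain ⟨h1, h2⟩ := heq
  have h3 : (x - y) ^ 2 = (x' - y') ^ 2 := by
    linear_combination (x + y + x' + y') * h1 - 4 * h2
  have h4 : x - y = x' - y' := (pow_left_inj₀ (by linarith) (by linarith) two_ne_zero).1 h3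
  ext <;> simp only <;> linarith

/-- The image determines `(x ± y)^2 = 1 ± u + v`, and both `x + y` and `x - y` are positive on the
quarter. -/
theorem toTri_injOn : Set.InjOn toTri rightQuarter := by
  rintro ⟨x, y⟩ ⟨⟨-, h⟩, h0⟩ ⟨x', y'⟩ ⟨⟨-, h'⟩, h0'⟩ heq
  simp only [toTri, Prod.mk.injEq] at heq h h' h0 h0'
  obtain ⟨h1, h2⟩ := heq
  have h3 : (x - y) ^ 2 = (x' - y') ^ 2 := by linear_combination h2 - h1
  have h4 : (x + y) ^ 2 = (x' + y') ^ 2 := by linear_combination h2 + h1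
  have h5 : x - y = x' - y' := (pow_left_inj₀ (by linarith) (by linarith) two_ne_zero).1 h3
  have h6 : x + y = x' + y' := (pow_left_inj₀ (by linarith) (by linarith) two_ne_zero).1 h4
  ext <;> simp only <;> linarith

theorem symMap_image : symMap '' lowerHalf = parTriangle := by
  ext ⟨u, v⟩
  simp only [parTriangle, Set.mem_ofPred_eq]
  constructor
  · rintro ⟨⟨x, y⟩, ⟨⟨⟨h1, h2⟩, h3, h4⟩, h5⟩, heq⟩
    simp only [symMap, Prod.mk.injEq] at heq h1 h2 h3 h4 h5
    obtain ⟨rfl, rfl⟩ := heq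
    refine ⟨?_, ?_, ?_, abs_lt.2 ⟨by linarith, by linarith⟩⟩
    · nlinarith [mul_pos (neg_lt_iff_pos_add'.1 h1) (neg_lt_iff_pos_add'.1 h3)]
    · nlinarith [mul_pos (sub_pos.2 h2) (sub_pos.2 h4)]
    · nlinarith [pow_pos (sub_pos.2 h5) 2]
  · rintro ⟨h1, h2, h3, h4⟩
    rw [abs_lt] at h4
    -- The preimage consists of the roots of `t^2 - u t + v`; the bounds `r < 2 ± u`, when squared,
    -- are the conditions `1 ± u + v > 0`.
    set r := Real.sqrt (u ^ 2 - 4 * v) with hr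
    have hr0 : 0 < r := Real.sqrt_pos.2 (by linarith)
    have hr2 : r ^ 2 = u ^ 2 - 4 * v := Real.sq_sqrt (by linarith)
    have h5 : r < 2 + u := lt_of_pow_lt_pow_left₀ 2 (by linarith) (by nlinarith)
    have h6 : r < 2 - u := lt_of_pow_lt_pow_left₀ 2 (by linarith) (by nlinarith)
    refine ⟨((u + r) / 2, (u - r) / 2), ⟨⟨⟨?_, ?_⟩, ?_, ?_⟩, ?_⟩, ?_⟩ <;>
      try simp only
    · linarith
    · linarith
    · linarith
    · linarith
    · linarith
    · simp only [symMap, Prod.mk.injEq]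
      exact ⟨by ring, by linear_combination (-1 / 4) * hr2⟩

theorem toTri_image : toTri '' rightQuarter = parTriangle := by
  ext ⟨u, v⟩
  simp only [parTriangle, Set.mem_ofPred_eq]
  constructor
  · rintro ⟨⟨x, y⟩, ⟨⟨⟨⟨h1, h2⟩, h3, h4⟩, h5⟩, h6⟩, heq⟩
    simp only [toTri, Prod.mk.injEq] at heq h1 h2 h3 h4 h5 h6
    obtain ⟨rfl, rfl⟩ := heq
    have hx : x ^ 2 < 1 := by nlinarith
    have hy : y ^ 2 < 1 := by nlinarith
    refine ⟨?_, ?_, ?_, ?_⟩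
    · nlinarith [pow_pos (neg_lt_iff_pos_add.1 h6) 2]
    · nlinarith [pow_pos (sub_pos.2 h5) 2]
    · nlinarith [mul_pos (sub_pos.2 hx) (sub_pos.2 hy)]
    · rw [abs_lt]
      constructor <;> nlinarith [sq_nonneg (x + y), sq_nonneg (x - y)]
  · rintro ⟨h1, h2, h3, h4⟩
    rw [abs_lt] at h4
    -- Here `r` and `s` are to be `x + y` and `x - y`. The condition `4v < u^2` becomes `r s < 1 -
    -- v`, which gives `(r + s)^2 < 4`.
    set r := Real.sqrt (1 + u + v) with hr
    set s := Real.sqrt (1 - u + v) with hs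
    have hr0 : 0 < r := Real.sqrt_pos.2 h1
    have hs0 : 0 < s := Real.sqrt_pos.2 h2
    have hr2 : r ^ 2 = 1 + u + v := Real.sq_sqrt h1.le
    have hs2 : s ^ 2 = 1 - u + v := Real.sq_sqrt h2.le
    have hv : v < 1 := by nlinarith
    have hrs : r * s < 1 - v :=
      lt_of_pow_lt_pow_left₀ 2 (by linarith) (by rw [mul_pow, hr2, hs2]; nlinarith)
    have h5 : r + s < 2 := lt_of_pow_lt_pow_left₀ 2 (by norm_num) (by nlinarith)
    refine ⟨((r + s) / 2, (r - s) / 2), ⟨⟨⟨⟨?_, ?_⟩, ?_, ?_⟩, ?_⟩, ?_⟩, ?_⟩ <;>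
      try simp only
    · linarith
    · linarith
    · linarith
    · linarith
    · linarith
    · linarith
    · simp only [toTri, Prod.mk.injEq]
      exact ⟨by linear_combination (hr2 - hs2) / 2, by linear_combination (hr2 + hs2) / 2⟩

/-- The product Jacobi weight. -/
def prodWeight (α β : ℝ) (p : ℝ × ℝ) : ℝ := jacWeight α β p.1 * jacWeight α β p.2

/-- The Jacobian `x - y` cancels the factor `(u^2 - 4v)^{-1/2}`. -/
theorem triWeight_symMap (α β : ℝ) {p : ℝ × ℝ} (hp : p ∈ lowerHalf) :
    |(planeMap 1 1 p.2 p.1).det| * triWeight α β (symMap p) = prodWeight α β p := by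
  obtain ⟨⟨⟨h1, h2⟩, h3, h4⟩, h5⟩ := hp
  have e1 : 1 - (p.1 + p.2) + p.1 * p.2 = (1 - p.1) * (1 - p.2) := by ring
  have e2 : 1 + (p.1 + p.2) + p.1 * p.2 = (1 + p.1) * (1 + p.2) := by ring
  have e3 : (p.1 + p.2) ^ 2 - 4 * (p.1 * p.2) = (p.1 - p.2) ^ 2 := by ring
  have h6 : 0 < p.1 - p.2 := sub_pos.2 h5
  have e4 : ((p.1 - p.2) ^ 2) ^ (-(1 / 2) : ℝ) = (p.1 - p.2)⁻¹ := by
    rw [← Real.rpow_natCast, ← Real.rpow_mul h6.le]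
    norm_num [Real.rpow_neg_one]
  rw [det_planeMap, one_mul, one_mul, abs_of_pos h6]
  simp only [triWeight, symMap, prodWeight, jacWeight]
  rw [e1, e2, e3, e4, Real.mul_rpow (by linarith) (by linarith),
    Real.mul_rpow (by linarith) (by linarith)]
  field_simp

/-- The Jacobian `4 (x - y)(x + y)` in absolute value raises the exponents `2α`, `2β` by one, and
`u^2 - 4v = 4 (1 - x^2)(1 - y^2)` contributes a factor `1/2`. -/
theorem triWeight_toTri (α β : ℝ) {p : ℝ × ℝ} (hp : p ∈ rightQuarter) :
    |(planeMap (2 * p.2) (2 * p.1) (2 * p.1) (2 * p.2)).det| * triWeight α β (toTri p) =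
      2 * sqWeight α β p := by
  obtain ⟨⟨⟨⟨h1, h2⟩, h3, h4⟩, h5⟩, h6⟩ := hp
  have e1 : 1 - 2 * p.1 * p.2 + (p.1 ^ 2 + p.2 ^ 2 - 1) = (p.1 - p.2) ^ 2 := by ring
  have e2 : 1 + 2 * p.1 * p.2 + (p.1 ^ 2 + p.2 ^ 2 - 1) = (p.1 + p.2) ^ 2 := by ring
  have e3 : (2 * p.1 * p.2) ^ 2 - 4 * (p.1 ^ 2 + p.2 ^ 2 - 1) =
      2 ^ 2 * ((1 - p.1 ^ 2) * (1 - p.2 ^ 2)) := by ring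
  have h7 : 0 < p.1 - p.2 := sub_pos.2 h5
  have h8 : 0 < p.1 + p.2 := by linarith
  have hx : 0 ≤ 1 - p.1 ^ 2 := by nlinarith
  have hy : 0 ≤ 1 - p.2 ^ 2 := by nlinarith
  have e4 : ((2 : ℝ) ^ 2) ^ (-(1 / 2) : ℝ) = 2⁻¹ := by
    rw [← Real.rpow_natCast, ← Real.rpow_mul (by norm_num)]
    norm_num [Real.rpow_neg_one]
  have e5 : ∀ z : ℝ, 0 < z → ∀ a : ℝ, (z ^ 2) ^ a * z = z ^ (2 * a + 1) := by
    intro z hz a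
    rw [Real.rpow_add_one hz.ne', Real.rpow_mul hz.le, Real.rpow_two]
  have e6 : |2 * p.2 * (2 * p.2) - 2 * p.1 * (2 * p.1)| = 4 * ((p.1 - p.2) * (p.1 + p.2)) := by
    rw [abs_of_neg] <;> nlinarith [mul_pos h7 h8]
  rw [det_planeMap, e6]
  simp only [triWeight, toTri, sqWeight]
  rw [e1, e2, e3, Real.mul_rpow (by norm_num) (mul_nonneg hx hy), Real.mul_rpow hx hy, e4,
    abs_of_pos h7, abs_of_pos h8, ← e5 _ h7, ← e5 _ h8]
  ring

/-- Integrability is transported as well, because that of the weight on the square is deduced from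
that of the product Jacobi weight. -/
theorem integral_symMap (α β : ℝ) (h : ℝ × ℝ → ℝ) :
    (IntegrableOn (fun p => h p * triWeight α β p) parTriangle ↔
      IntegrableOn (fun p => h (symMap p) * prodWeight α β p) lowerHalf) ∧
    ∫ p in parTriangle, h p * triWeight α β p =
      ∫ p in lowerHalf, h (symMap p) * prodWeight α β p := by
  have hd : ∀ p ∈ lowerHalf, HasFDerivWithinAt symMap (planeMap 1 1 p.2 p.1) lowerHalf p :=
    fun p _ => (hasFDerivAt_symMap p).hasFDerivWithinAt
  have hc : Set.EqOn (fun p : ℝ × ℝ => |(planeMap 1 1 p.2 p.1).det| •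
      (h (symMap p) * triWeight α β (symMap p)))
      (fun p => h (symMap p) * prodWeight α β p) lowerHalf := fun p hp => by
    simp only [smul_eq_mul]
    rw [mul_left_comm, triWeight_symMap α β hp]
  rw [← symMap_image]
  constructor
  · rw [integrableOn_image_iff_integrableOn_abs_det_fderiv_smul volume measurableSet_lowerHalf hd
      symMap_injOn, integrableOn_congr_fun hc measurableSet_lowerHalf]
  · rw [integral_image_eq_integral_abs_det_fderiv_smul volume measurableSet_lowerHalf hd
      symMap_injOn, setIntegral_congr_fun measurableSet_lowerHalf hc]

theorem integral_toTri (α β : ℝ) (h : ℝ × ℝ → ℝ) :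
    (IntegrableOn (fun p => h p * triWeight α β p) parTriangle ↔
      IntegrableOn (fun p => 2 * (h (toTri p) * sqWeight α β p)) rightQuarter) ∧
    ∫ p in parTriangle, h p * triWeight α β p =
      ∫ p in rightQuarter, 2 * (h (toTri p) * sqWeight α β p) := by
  have hd : ∀ p ∈ rightQuarter, HasFDerivWithinAt toTri
      (planeMap (2 * p.2) (2 * p.1) (2 * p.1) (2 * p.2)) rightQuarter p :=
    fun p _ => (hasFDerivAt_toTri p).hasFDerivWithinAt
  have hc : Set.EqOn (fun p : ℝ × ℝ =>
      |(planeMap (2 * p.2) (2 * p.1) (2 * p.1) (2 * p.2)).det| •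
        (h (toTri p) * triWeight α β (toTri p)))
      (fun p => 2 * (h (toTri p) * sqWeight α β p)) rightQuarter := fun p hp => by
    simp only [smul_eq_mul]
    rw [mul_left_comm, triWeight_toTri α β hp]
    ring
  rw [← toTri_image]
  constructor
  · rw [integrableOn_image_iff_integrableOn_abs_det_fderiv_smul volume measurableSet_rightQuarter hd
      toTri_injOn, integrableOn_congr_fun hc measurableSet_rightQuarter]
  · rw [integral_image_eq_integral_abs_det_fderiv_smul volume measurableSet_rightQuarter hd
      toTri_injOn, setIntegral_congr_fun measurableSet_rightQuarter hc]

/-! ### The normalized integrals as functionals on continuous functions -/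

/-- A functional on functions of two variables that is linear on continuous functions. -/
structure IsLinearMean (I : (ℝ × ℝ → ℝ) → ℝ) : Prop where
  add : ∀ f g, Continuous f → Continuous g → I (fun p => f p + g p) = I f + I g
  const_mul : ∀ c f, I (fun p => c * f p) = c * I f

theorem IsLinearMean.sum {I : (ℝ × ℝ → ℝ) → ℝ} (hI : IsLinearMean I) {ι : Type*} (s : Finset ι)
    (c : ι → ℝ) (f : ι → ℝ × ℝ → ℝ) (hf : ∀ i, Continuous (f i)) :
    I (fun p => ∑ i ∈ s, c i * f i p) = ∑ i ∈ s, c i * I (f i) := by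
  classical
  induction s using Finset.induction_on with
  | empty =>
    simp only [Finset.sum_empty]
    simpa using hI.const_mul 0 fun _ => 0
  | insert a s ha ih =>
    simp only [Finset.sum_insert ha]
    rw [hI.add _ _ (by fun_prop) (by fun_prop), hI.const_mul, ih]

theorem IsLinearMean.sum_mul_sum {I : (ℝ × ℝ → ℝ) → ℝ} (hI : IsLinearMean I) {ι κ : Type*}
    (s : Finset ι) (t : Finset κ) (c : ι → ℝ) (d : κ → ℝ) (f : ι → ℝ × ℝ → ℝ)
    (g : κ → ℝ × ℝ → ℝ) (hf : ∀ i, Continuous (f i)) (hg : ∀ i, Continuous (g i)) :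
    I (fun p => (∑ i ∈ s, c i * f i p) * ∑ j ∈ t, d j * g j p) =
      ∑ i ∈ s, ∑ j ∈ t, c i * d j * I (fun p => f i p * g j p) := by
  have h1 : ∀ p, (∑ i ∈ s, c i * f i p) * ∑ j ∈ t, d j * g j p =
      ∑ i ∈ s, c i * (fun q => ∑ j ∈ t, d j * (f i q * g j q)) p := fun p => by
    rw [Finset.sum_mul]
    refine Finset.sum_congr rfl fun i _ => ?_
    rw [mul_assoc, Finset.mul_sum]
    exact congrArg _ (Finset.sum_congr rfl fun j _ => by ring)
  simp only [h1]
  rw [hI.sum s c (fun i q => ∑ j ∈ t, d j * (f i q * g j q)) (fun i => by fun_prop)]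
  refine Finset.sum_congr rfl fun i _ => ?_
  rw [hI.sum t d (fun j q => f i q * g j q) (fun j => by fun_prop), Finset.mul_sum]
  exact Finset.sum_congr rfl fun j _ => by ring

theorem isLinearMean_of_integrableOn {S : Set (ℝ × ℝ)} {W : ℝ × ℝ → ℝ} (M : ℝ)
    (h : ∀ f : ℝ × ℝ → ℝ, Continuous f → IntegrableOn (fun p => f p * W p) S) :
    IsLinearMean fun f => (∫ p in S, f p * W p) / M where
  add f g hf hg := by
    simp only [add_mul]
    rw [integral_add (h f hf) (h g hg), add_div]
  const_mul c f := by
    simp only [mul_assoc]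
    rw [integral_const_mul, mul_div_assoc]

/-- The integral over the open square against the product of two Jacobi weights of total mass
one. -/
def prodMean (α β : ℝ) (H : ℝ × ℝ → ℝ) : ℝ :=
  (∫ p in openSquare, H p * prodWeight α β p) / (∫ t in (-1 : ℝ)..1, jacWeight α β t) ^ 2

theorem setIntegral_prod_openSquare (α β : ℝ) (f g : ℝ → ℝ) :
    ∫ p in openSquare, f p.1 * g p.2 * prodWeight α β p =
      (∫ t in (-1 : ℝ)..1, f t * jacWeight α β t) * ∫ t in (-1 : ℝ)..1, g t * jacWeight α β t := by
  rw [intervalIntegral.integral_of_le (by norm_num), intervalIntegral.integral_of_le (by norm_num),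
    integral_Ioc_eq_integral_Ioo, integral_Ioc_eq_integral_Ioo, openSquare,
    Measure.volume_eq_prod, ← setIntegral_prod_mul]
  refine integral_congr_ae (Filter.Eventually.of_forall fun p => ?_)
  simp only [prodWeight]
  ring

theorem prodMean_mul (α β : ℝ) (f g : ℝ → ℝ) :
    prodMean α β (fun p => f p.1 * g p.2) = jacMean α β f * jacMean α β g := by
  rw [prodMean, setIntegral_prod_openSquare, jacMean, jacMean, sq, mul_div_mul_comm]

/-! ### Transport of integrals between the square, the parabolic triangle and the product weight -/

section
variable {α β : ℝ} (hα : -1 < α) (hβ : -1 < β)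
include hα hβ

theorem integrableOn_mul_prodWeight {f : ℝ × ℝ → ℝ} (hf : Continuous f) :
    IntegrableOn (fun p => f p * prodWeight α β p) openSquare := by
  have h1 : IntegrableOn (jacWeight α β) (Set.Ioo (-1) 1) :=
    (intervalIntegrable_jacWeight hα hβ).1.mono_set Set.Ioo_subset_Ioc_self
  have h2 : IntegrableOn (prodWeight α β) openSquare := by
    rw [openSquare, IntegrableOn, Measure.volume_eq_prod, ← Measure.prod_restrict]
    exact h1.integrable.mul_prod h1.integrable
  exact h2.continuousOn_mul_of_subset (K := square) hf.continuousOn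
    (isCompact_Icc.prod isCompact_Icc) isOpen_openSquare.measurableSet
    (Set.prod_mono Set.Ioo_subset_Icc_self Set.Ioo_subset_Icc_self)

theorem isLinearMean_prodMean : IsLinearMean (prodMean α β) :=
  isLinearMean_of_integrableOn _ fun _ hf => integrableOn_mul_prodWeight hα hβ hf

omit hα hβ in
theorem integral_parTriangle_eq (h : ℝ × ℝ → ℝ) :
    ∫ p in parTriangle, h p * triWeight α β p =
      (∫ p in openSquare, h (symMap p) * prodWeight α β p) / 2 := by
  rw [(integral_symMap α β h).2, (setIntegral_openSquare _).2, mul_div_cancel_left₀ _ two_ne_zero]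
  intro p
  simp only [symMap, prodWeight, Prod.fst_swap, Prod.snd_swap, add_comm p.2, mul_comm p.2,
    mul_comm (jacWeight α β p.2)]

omit hα hβ in
theorem triMass_eq : triMass α β = (∫ t in (-1 : ℝ)..1, jacWeight α β t) ^ 2 / 2 := by
  have h := integral_parTriangle_eq (α := α) (β := β) fun _ => 1
  have h' := setIntegral_prod_openSquare α β (fun _ => 1) fun _ => 1
  simp only [one_mul] at h h'
  rw [triMass, h, h', sq]

theorem triMass_pos : 0 < triMass α β := by
  rw [triMass_eq]
  have := integral_jacWeight_pos hα hβ
  positivity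

omit hα hβ in
theorem triMean_eq_prodMean (h : ℝ × ℝ → ℝ) :
    triMean α β h = prodMean α β fun p => h (symMap p) := by
  rw [triMean, prodMean, integral_parTriangle_eq, triMass_eq,
    div_div_div_cancel_right₀ two_ne_zero]

theorem isLinearMean_triMean : IsLinearMean (triMean α β) where
  add f g hf hg := by
    simp only [triMean_eq_prodMean]
    exact (isLinearMean_prodMean hα hβ).add _ _ (hf.comp continuous_symMap)
      (hg.comp continuous_symMap)
  const_mul c f := by
    simp only [triMean_eq_prodMean]
    exact (isLinearMean_prodMean hα hβ).const_mul _ _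

omit hα hβ in
theorem sqWeight_swap (p : ℝ × ℝ) : sqWeight α β p.swap = sqWeight α β p := by
  simp only [sqWeight, Prod.fst_swap, Prod.snd_swap, abs_sub_comm p.2, add_comm p.2]
  ring

omit hα hβ in
theorem sqWeight_neg (p : ℝ × ℝ) : sqWeight α β (-p) = sqWeight α β p := by
  simp only [sqWeight, Prod.fst_neg, Prod.snd_neg, neg_sq]
  rw [show -p.1 - -p.2 = -(p.1 - p.2) by ring, show -p.1 + -p.2 = -(p.1 + p.2) by ring,
    abs_neg, abs_neg]

omit hα hβ in
theorem toTri_swap (p : ℝ × ℝ) : toTri p.swap = toTri p := by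
  simp only [toTri, Prod.fst_swap, Prod.snd_swap, Prod.mk.injEq]
  constructor <;> ring

omit hα hβ in
theorem toTri_neg (p : ℝ × ℝ) : toTri (-p) = toTri p := by
  simp only [toTri, Prod.fst_neg, Prod.snd_neg, Prod.mk.injEq]
  constructor <;> ring

omit hα hβ in
-- The square consists of four mirror images of the quarter, and the change of variables carries a
-- factor `2`; hence `4 / 2`.
theorem integral_square_comp_toTri (h : ℝ × ℝ → ℝ) :
    (IntegrableOn (fun p => h (toTri p) * sqWeight α β p) square ↔
      IntegrableOn (fun p => h p * triWeight α β p) parTriangle) ∧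
    ∫ p in square, h (toTri p) * sqWeight α β p =
      2 * ∫ p in parTriangle, h p * triWeight α β p := by
  have h1 := setIntegral_openSquare (G := fun p => h (toTri p) * sqWeight α β p)
    fun p => by simp only [toTri_swap, sqWeight_swap]
  have h2 := setIntegral_lowerHalf (G := fun p => h (toTri p) * sqWeight α β p)
    fun p => by simp only [toTri_neg, sqWeight_neg, toTri_swap, sqWeight_swap]
  have h3 := integral_toTri α β h
  constructor
  · rw [integrableOn_congr_set_ae square_ae_eq, h1.1, h2.1, h3.1]
    exact (integrable_const_mul_iff (isUnit_iff_ne_zero.2 two_ne_zero) _).symm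
  · rw [setIntegral_congr_set square_ae_eq, h1.2, h2.2, h3.2, integral_const_mul]

omit hα hβ in
theorem sqMean_comp_toTri (h : ℝ × ℝ → ℝ) :
    sqMean α β (fun p => h (toTri p)) = triMean α β h := by
  have h1 := (integral_square_comp_toTri (α := α) (β := β) fun _ => 1).2
  simp only [one_mul] at h1
  rw [sqMean, triMean, triMass, (integral_square_comp_toTri h).2, h1,
    mul_div_mul_left _ _ two_ne_zero]

theorem integrableOn_mul_sqWeight {f : ℝ × ℝ → ℝ} (hf : Continuous f) :
    IntegrableOn (fun p => f p * sqWeight α β p) square := by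
  have h1 : IntegrableOn (sqWeight α β) square := by
    have h2 := (integral_square_comp_toTri (α := α) (β := β) fun _ => 1).1
    have h3 := (integral_symMap α β fun _ => 1).1
    have h4 := (setIntegral_openSquare (G := prodWeight α β) fun p => by
      simp only [prodWeight, Prod.fst_swap, Prod.snd_swap, mul_comm (jacWeight α β p.2)]).1
    have h5 := integrableOn_mul_prodWeight hα hβ (f := fun _ => 1) continuous_const
    simp only [one_mul] at h2 h3 h4 h5
    exact h2.2 (h3.2 (h4.1 h5))
  exact h1.continuousOn_mul_of_subset hf.continuousOn (isCompact_Icc.prod isCompact_Icc)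
    (measurableSet_Icc.prod measurableSet_Icc) subset_rfl

theorem isLinearMean_sqMean : IsLinearMean (sqMean α β) :=
  isLinearMean_of_integrableOn _ fun _ hf => integrableOn_mul_sqWeight hα hβ hf

omit hα hβ in
theorem sqMean_comp_swap (f : ℝ × ℝ → ℝ) :
    sqMean α β (fun p => f p.swap) = sqMean α β f := by
  have h := measurePreserving_prodSwap.setIntegral_preimage_emb measurableEmbedding_prodSwap
    (fun p => f p * sqWeight α β p) square
  have hs : Prod.swap ⁻¹' square = square := by
    ext p; exact and_comm
  simp only [hs, sqWeight_swap] at h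
  rw [sqMean, sqMean, h]

omit hα hβ in
theorem sqMean_comp_neg (f : ℝ × ℝ → ℝ) :
    sqMean α β (fun p => f (-p)) = sqMean α β f := by
  have h := (Measure.measurePreserving_neg (volume : Measure (ℝ × ℝ))).setIntegral_preimage_emb
    measurableEmbedding_prodNeg (fun p => f p * sqWeight α β p) square
  have hs : Neg.neg ⁻¹' square = square := by
    ext p
    simp only [square, Set.mem_preimage, Set.mem_prod, Set.mem_Icc, Prod.fst_neg, Prod.snd_neg]
    constructor <;> rintro ⟨⟨_, _⟩, _, _⟩ <;> refine ⟨⟨?_, ?_⟩, ?_, ?_⟩ <;> linarith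
  simp only [hs, sqWeight_neg] at h
  rw [sqMean, sqMean, h]

theorem sqMean_eq_zero_of_odd {F : ℝ × ℝ → ℝ} (hF : ∀ p, F (-p) = -F p) : sqMean α β F = 0 := by
  have h1 := sqMean_comp_neg (α := α) (β := β) F
  have h2 := (isLinearMean_sqMean hα hβ).const_mul (-1) F
  simp only [hF] at h1
  simp only [neg_one_mul] at h2
  linarith

/-- The weight is symmetric, so only the symmetrization of `F` matters. -/
theorem sqMean_eq_triMean {F h : ℝ × ℝ → ℝ} (hF : Continuous F)
    (hFh : ∀ p, F p + F p.swap = 2 * h (toTri p)) : sqMean α β F = triMean α β h := by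
  have h1 := (isLinearMean_sqMean hα hβ).add F (fun p => F p.swap) hF (hF.comp continuous_swap)
  simp only [hFh] at h1
  rw [(isLinearMean_sqMean hα hβ).const_mul, sqMean_comp_toTri, sqMean_comp_swap] at h1
  linarith

omit hα hβ in
theorem sqWeight_nonneg {p : ℝ × ℝ} (hp : p ∈ square) : 0 ≤ sqWeight α β p := by
  obtain ⟨⟨h1, h2⟩, h3, h4⟩ := hp
  have hx : 0 ≤ 1 - p.1 ^ 2 := by nlinarith
  have hy : 0 ≤ 1 - p.2 ^ 2 := by nlinarith
  unfold sqWeight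
  positivity

omit hα hβ in
theorem sqWeight_pos {p : ℝ × ℝ} (hp : p ∈ openSquare) (h : p.2 ≠ 1 * p.1)
    (h' : p.2 ≠ -1 * p.1) : 0 < sqWeight α β p := by
  obtain ⟨⟨h1, h2⟩, h3, h4⟩ := hp
  have hx : 0 < 1 - p.1 ^ 2 := by nlinarith
  have hy : 0 < 1 - p.2 ^ 2 := by nlinarith
  have h5 : 0 < |p.1 - p.2| := abs_pos.2 fun h0 => h (by linarith)
  have h6 : 0 < |p.1 + p.2| := abs_pos.2 fun h0 => h' (by linarith)
  unfold sqWeight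
  positivity

/-- The integrand is positive on a nonempty open set from which the two diagonals, where the weight
may fail to be positive, are removed. -/
theorem sqMean_pos {f : ℝ × ℝ → ℝ} (hf : Continuous f) (hf0 : ∀ p, 0 ≤ f p) {p₀ : ℝ × ℝ}
    (hp₀ : p₀ ∈ openSquare) (hp₀' : f p₀ ≠ 0) : 0 < sqMean α β f := by
  have key : ∀ f : ℝ × ℝ → ℝ, Continuous f → (∀ p, 0 ≤ f p) → f p₀ ≠ 0 →
      0 < ∫ p in square, f p * sqWeight α β p := by
    intro f hf hf0 hp₀'
    have hm : MeasurableSet square := measurableSet_Icc.prod measurableSet_Icc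
    rw [setIntegral_pos_iff_support_of_nonneg_ae _ (integrableOn_mul_sqWeight hα hβ hf)]
    · have hopen : IsOpen (openSquare ∩ {p | f p ≠ 0}) :=
        isOpen_openSquare.inter (isOpen_ne_fun hf continuous_const)
      have hpos := hopen.measure_pos volume ⟨p₀, hp₀, hp₀'⟩
      rw [← measure_sdiff_null (volume_line_eq_zero 1),
        ← measure_sdiff_null (volume_line_eq_zero (-1))] at hpos
      refine hpos.trans_le (measure_mono ?_)
      rintro p ⟨⟨⟨hp, hfp⟩, h1⟩, h2⟩
      exact ⟨mul_ne_zero hfp (sqWeight_pos hp h1 h2).ne',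
        Set.prod_mono Set.Ioo_subset_Icc_self Set.Ioo_subset_Icc_self hp⟩
    · filter_upwards [ae_restrict_mem hm] with p hp
      exact mul_nonneg (hf0 p) (sqWeight_nonneg hp)
  refine div_pos (key f hf hf0 hp₀') ?_
  simpa using key (fun _ => 1) continuous_const (fun _ => zero_le_one) one_ne_zero

end

/-! ### Polynomials of bounded degree in each of two variables -/

theorem continuous_mono (e : ℕ × ℕ) : Continuous (mono e) := by unfold mono; fun_prop

/-- Polynomials of degree at most `n` in each of the two variables. -/
def biDeg (n : ℕ) : Submodule ℝ (ℝ × ℝ → ℝ) :=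
  Submodule.span ℝ (mono '' {e | e.1 ≤ n ∧ e.2 ≤ n})

theorem mono_mem_biDeg {n i j : ℕ} (hi : i ≤ n) (hj : j ≤ n) : mono (i, j) ∈ biDeg n :=
  Submodule.subset_span ⟨(i, j), ⟨hi, hj⟩, rfl⟩

theorem biDeg_le {n k : ℕ} (h : n ≤ k) : biDeg n ≤ biDeg k :=
  Submodule.span_mono (Set.image_mono fun _ he => ⟨he.1.trans h, he.2.trans h⟩)

theorem mul_mem_biDeg {n k : ℕ} {f g : ℝ × ℝ → ℝ} (hf : f ∈ biDeg n) (hg : g ∈ biDeg k) :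
    (fun p => f p * g p) ∈ biDeg (n + k) := by
  have h : f * g ∈ biDeg n * biDeg k := Submodule.mul_mem_mul hf hg
  rw [biDeg, biDeg, Submodule.span_mul_span] at h
  refine Submodule.span_mono ?_ h
  rintro _ ⟨_, ⟨d, hd, rfl⟩, _, ⟨e, he, rfl⟩, rfl⟩
  refine ⟨(d.1 + e.1, d.2 + e.2), ⟨add_le_add hd.1 he.1, add_le_add hd.2 he.2⟩, ?_⟩
  funext p
  simp only [mono, Pi.mul_apply, pow_add]
  ring

theorem const_mem_biDeg (n : ℕ) (c : ℝ) : (fun _ : ℝ × ℝ => c) ∈ biDeg n := by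
  convert (biDeg n).smul_mem c (mono_mem_biDeg (Nat.zero_le n) (Nat.zero_le n)) using 1
  funext p
  simp [mono]

theorem symMap_fst_mem_biDeg : (fun p => (symMap p).1) ∈ biDeg 1 := by
  convert (biDeg 1).add_mem (mono_mem_biDeg le_rfl zero_le_one)
    (mono_mem_biDeg zero_le_one le_rfl) using 1
  funext p
  simp [mono, symMap]

theorem symMap_snd_mem_biDeg : (fun p => (symMap p).2) ∈ biDeg 1 := by
  convert mono_mem_biDeg (n := 1) le_rfl le_rfl using 1
  funext p
  simp [mono, symMap]

/-- If a function satisfies the recursion of the power sums of the squares and its first two values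
are polynomials in `toTri` of the proper degree, then so are all its values. -/
theorem exists_comp_toTri_of_recursion (S : ℕ → ℝ × ℝ → ℝ)
    (hrec : ∀ c p, S (c + 2) p = (p.1 ^ 2 + p.2 ^ 2) * S (c + 1) p - (p.1 * p.2) ^ 2 * S c p)
    (h0 : ∃ g : ℝ × ℝ → ℝ, (fun p => g (symMap p)) ∈ biDeg 0 ∧ ∀ p, S 0 p = g (toTri p))
    (h1 : ∃ g : ℝ × ℝ → ℝ, (fun p => g (symMap p)) ∈ biDeg 1 ∧ ∀ p, S 1 p = g (toTri p))
    (c : ℕ) :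
    ∃ g : ℝ × ℝ → ℝ, (fun p => g (symMap p)) ∈ biDeg c ∧ ∀ p, S c p = g (toTri p) := by
  induction c using Nat.twoStepInduction with
  | zero => exact h0
  | one => exact h1
  | more c ih ih' =>
    obtain ⟨g, hg, hS⟩ := ih
    obtain ⟨g', hg', hS'⟩ := ih'
    -- On the image of `toTri`, `x^2 + y^2 = v + 1` and `(x y)^2 = u^2 / 4`.
    refine ⟨fun q => (q.2 + 1) * g' q - 1 / 4 * (q.1 * q.1) * g q, ?_, fun p => ?_⟩
    · have e1 := mul_mem_biDeg ((biDeg 1).add_mem symMap_snd_mem_biDeg (const_mem_biDeg 1 1)) hg'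
      have e2 := mul_mem_biDeg (mul_mem_biDeg (const_mem_biDeg 0 (1 / 4))
        (mul_mem_biDeg symMap_fst_mem_biDeg symMap_fst_mem_biDeg)) hg
      rw [show 1 + (c + 1) = c + 2 by ring] at e1
      rw [show 0 + (1 + 1) + c = c + 2 by ring] at e2
      exact (biDeg (c + 2)).sub_mem e1 e2
    · rw [hrec, hS, hS']
      simp only [toTri]
      ring

theorem mono_swap (a b : ℕ) (p : ℝ × ℝ) : mono (a, b) p.swap = mono (b, a) p := by
  simp only [mono, Prod.fst_swap, Prod.snd_swap, mul_comm]

theorem mono_neg (e : ℕ × ℕ) (p : ℝ × ℝ) : mono e (-p) = (-1) ^ (e.1 + e.2) * mono e p := by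
  simp only [mono, Prod.fst_neg, Prod.snd_neg]
  rw [neg_pow, neg_pow p.2, pow_add]
  ring

theorem pow_symMap_fst_mem_biDeg (b : ℕ) : (fun p => ((symMap p).1 / 2) ^ b) ∈ biDeg b := by
  induction b with
  | zero => simpa using const_mem_biDeg 0 1
  | succ b ih =>
    convert mul_mem_biDeg ih (mul_mem_biDeg (const_mem_biDeg 0 (1 / 2)) symMap_fst_mem_biDeg) using 1
    funext p
    ring

/-- The symmetrization of a monomial of even degree `2 n`. -/
theorem exists_mono_add_swap_of_even {a b n : ℕ} (h : a + b = 2 * n) :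
    ∃ g : ℝ × ℝ → ℝ, (fun p => g (symMap p)) ∈ biDeg n ∧
      ∀ p, mono (a, b) p + mono (a, b) p.swap = 2 * g (toTri p) := by
  wlog hab : b ≤ a generalizing a b
  · obtain ⟨g, hg, hgp⟩ := this (by lia : b + a = 2 * n) (by lia)
    refine ⟨g, hg, fun p => ?_⟩
    rw [← hgp p, mono_swap, mono_swap, add_comm]
  -- The symmetrization is `(x y)^b (x^{2c} + y^{2c})`, with `x y = u / 2` and `b + c = n`.
  obtain ⟨c, rfl⟩ : ∃ c, a = b + 2 * c := ⟨n - b, by lia⟩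
  obtain ⟨g, hg, hgp⟩ := exists_comp_toTri_of_recursion
    (fun c p => (p.1 ^ (2 * c) + p.2 ^ (2 * c)) / 2) (fun c p => by ring)
    ⟨fun _ => 1, const_mem_biDeg 0 1, fun p => by simp⟩
    ⟨fun q => 1 / 2 * (q.2 + 1), by
      simpa using mul_mem_biDeg (const_mem_biDeg 0 (1 / 2))
        ((biDeg 1).add_mem symMap_snd_mem_biDeg (const_mem_biDeg 1 1)),
      fun p => by simp only [toTri]; ring⟩ c
  refine ⟨fun q => (q.1 / 2) ^ b * g q, ?_, fun p => ?_⟩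
  · have := mul_mem_biDeg (pow_symMap_fst_mem_biDeg b) hg
    rwa [show b + c = n by lia] at this
  · simp only [← hgp, mono_swap]
    simp only [mono, toTri]
    rw [show 2 * p.1 * p.2 / 2 = p.1 * p.2 by ring]
    ring

/-- The quotient of `x ^ (2 c + 1) + y ^ (2 c + 1)` by `x + y`. -/
def oddQuot (p : ℝ × ℝ) : ℕ → ℝ
  | 0 => 1
  | 1 => p.1 ^ 2 - p.1 * p.2 + p.2 ^ 2
  | c + 2 => (p.1 ^ 2 + p.2 ^ 2) * oddQuot p (c + 1) - (p.1 * p.2) ^ 2 * oddQuot p c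

theorem add_mul_oddQuot (p : ℝ × ℝ) (c : ℕ) :
    (p.1 + p.2) * oddQuot p c = p.1 ^ (2 * c + 1) + p.2 ^ (2 * c + 1) := by
  induction c using Nat.twoStepInduction with
  | zero => simp [oddQuot]
  | one => simp only [oddQuot]; ring
  | more c ih ih' =>
    simp only [oddQuot]
    linear_combination (p.1 ^ 2 + p.2 ^ 2) * ih' - (p.1 * p.2) ^ 2 * ih

/-- The symmetrization of a monomial of odd degree `2 n + 1`. -/
theorem exists_mono_add_swap_of_odd {a b n : ℕ} (h : a + b = 2 * n + 1) :
    ∃ g : ℝ × ℝ → ℝ, (fun p => g (symMap p)) ∈ biDeg n ∧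
      ∀ p, mono (a, b) p + mono (a, b) p.swap = (p.1 + p.2) * g (toTri p) := by
  wlog hab : b ≤ a generalizing a b
  · obtain ⟨g, hg, hgp⟩ := this (by lia : b + a = 2 * n + 1) (by lia)
    refine ⟨g, hg, fun p => ?_⟩
    rw [← hgp p, mono_swap, mono_swap, add_comm]
  obtain ⟨c, rfl⟩ : ∃ c, a = b + (2 * c + 1) := ⟨n - b, by lia⟩
  obtain ⟨g, hg, hgp⟩ := exists_comp_toTri_of_recursion (fun c p => oddQuot p c)
    (fun c p => rfl) ⟨fun _ => 1, const_mem_biDeg 0 1, fun p => rfl⟩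
    -- This is `x^2 - x y + y^2` in terms of `u` and `v`.
    ⟨fun q => q.2 + 1 - 1 / 2 * q.1, by
      have e1 := (biDeg 1).add_mem symMap_snd_mem_biDeg (const_mem_biDeg 1 1)
      have e2 := mul_mem_biDeg (const_mem_biDeg 0 (1 / 2)) symMap_fst_mem_biDeg
      rw [zero_add] at e2
      exact (biDeg 1).sub_mem e1 e2,
      fun p => by simp only [toTri, oddQuot]; ring⟩ c
  refine ⟨fun q => (q.1 / 2) ^ b * g q, ?_, fun p => ?_⟩
  · have := mul_mem_biDeg (pow_symMap_fst_mem_biDeg b) hg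
    rwa [show b + c = n by lia] at this
  · have e := add_mul_oddQuot p c
    simp only [← hgp, mono_swap]
    simp only [mono, toTri]
    rw [show 2 * p.1 * p.2 / 2 = p.1 * p.2 by ring, mul_left_comm, e]
    ring

/-! ### The cubature rule -/

/-- The cubature rule with the nodes `x_{j,k}^{(i)}`. -/
def nodeSum (α β : ℝ) (m : ℕ) (F : ℝ × ℝ → ℝ) : ℝ :=
  ∑ k ∈ Finset.range (m + 1), ∑ j ∈ Finset.range (k + 1), ∑ i : Fin 4,
    (if j = k then 1 / 4 else 1 / 2) * radauCoeff α β m j * radauCoeff α β m k *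
      F (node α β m j k i)

/-- The product of two Gauss-Radau rules. -/
def gridSum (α β : ℝ) (m : ℕ) (H : ℝ × ℝ → ℝ) : ℝ :=
  ∑ j ∈ Finset.range (m + 1), ∑ k ∈ Finset.range (m + 1),
    radauCoeff α β m j * radauCoeff α β m k * H (radauNode α β m j, radauNode α β m k)

/-- Accounts for the factors of the node sum: four symmetric nodes with factor `1/2`, or `1/4` if `j
= k`, give an off-diagonal term twice and a diagonal one once. -/
theorem sum_range_triangle_eq (T : ℕ → ℕ → ℝ) (hT : ∀ j k, T j k = T k j) (n : ℕ) :
    ∑ k ∈ Finset.range n, ∑ j ∈ Finset.range (k + 1), (if j = k then 1 else 2) * T j k =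
      ∑ j ∈ Finset.range n, ∑ k ∈ Finset.range n, T j k := by
  induction n with
  | zero => simp
  | succ n ih =>
    rw [Finset.sum_range_succ, ih, Finset.sum_range_succ (n := n), if_pos rfl, one_mul]
    simp only [Finset.sum_range_succ _ n, Finset.sum_add_distrib]
    have h1 : ∑ j ∈ Finset.range n, (if j = n then 1 else 2) * T j n =
        2 * ∑ j ∈ Finset.range n, T j n := by
      rw [Finset.mul_sum]
      exact Finset.sum_congr rfl fun j hj => by
        rw [if_neg (Finset.mem_range.1 hj).ne]
    have h2 : ∑ k ∈ Finset.range n, T n k = ∑ k ∈ Finset.range n, T k n :=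
      Finset.sum_congr rfl fun k _ => hT n k
    rw [h1, h2]
    ring

section
variable {α β : ℝ} (hα : -1 < α) (hβ : -1 < β)
include hα hβ

theorem cos_radauAngle {m k : ℕ} (hk : k ≤ m) :
    Real.cos (radauAngle α β m k) = radauNode α β m k := by
  have := radauNode_mem hα hβ hk
  exact Real.cos_arccos this.1.le this.2

omit hα hβ in
/-- The four nodes with the same indices are obtained from the first by symmetries. -/
theorem node_eq (α β : ℝ) (m j k : ℕ) :
    node α β m j k 1 = (node α β m j k 0).swap ∧ node α β m j k 2 = -node α β m j k 0 ∧
      node α β m j k 3 = -(node α β m j k 0).swap := by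
  simp [node]

/-- These are `2 cos a cos b = cos (a + b) + cos (a - b)` and `cos² a + cos² b - 1 = cos (a + b) cos
(a - b)` at the half difference and half sum of the angles. -/
theorem toTri_node_zero {m j k : ℕ} (hj : j ≤ m) (hk : k ≤ m) :
    toTri (node α β m j k 0) = symMap (radauNode α β m j, radauNode α β m k) := by
  rw [← cos_radauAngle hα hβ hj, ← cos_radauAngle hα hβ hk]
  set θ := radauAngle α β m j
  set φ := radauAngle α β m k
  have h1 : Real.cos θ = Real.cos ((θ - φ) / 2 + (θ + φ) / 2) := by ring_nf
  have h2 : Real.cos φ = Real.cos ((θ + φ) / 2 - (θ - φ) / 2) := by ring_nf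
  have h3 : node α β m j k 0 = (Real.cos ((θ - φ) / 2), Real.cos ((θ + φ) / 2)) := rfl
  rw [h1, h2, h3, Real.cos_add, Real.cos_sub]
  simp only [toTri, symMap, Prod.mk.injEq]
  set a := (θ - φ) / 2
  set b := (θ + φ) / 2
  constructor
  · ring
  · have ha := Real.sin_sq a
    have hb := Real.sin_sq b
    linear_combination (1 - Real.cos b ^ 2) * ha + Real.sin a ^ 2 * hb

omit hα hβ in
-- The four nodes form two antipodal pairs with equal weights.
theorem nodeSum_eq_zero_of_odd {m : ℕ} {F : ℝ × ℝ → ℝ} (hF : ∀ p, F (-p) = -F p) :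
    nodeSum α β m F = 0 := by
  refine Finset.sum_eq_zero fun k _ => Finset.sum_eq_zero fun j _ => ?_
  obtain ⟨h1, h2, h3⟩ := node_eq α β m j k
  rw [Fin.sum_univ_four, h1, h2, h3, hF, hF]
  ring

theorem nodeSum_eq_gridSum {m : ℕ} {F h : ℝ × ℝ → ℝ} (hF : ∀ p, F (-p) = F p)
    (hFh : ∀ p, F p + F p.swap = 2 * h (toTri p)) :
    nodeSum α β m F = gridSum α β m fun p => h (symMap p) := by
  rw [gridSum, ← sum_range_triangle_eq]
  · refine Finset.sum_congr rfl fun k hk => Finset.sum_congr rfl fun j hj => ?_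
    rw [Finset.mem_range] at hk hj
    obtain ⟨h1, h2, h3⟩ := node_eq α β m j k
    have h4 := hFh (node α β m j k 0)
    rw [toTri_node_zero hα hβ (by lia) (by lia)] at h4
    rw [Fin.sum_univ_four, h1, h2, h3, hF, hF]
    split_ifs
    · linear_combination (radauCoeff α β m j * radauCoeff α β m k / 2) * h4
    · linear_combination (radauCoeff α β m j * radauCoeff α β m k) * h4
  · intro j k
    rw [mul_comm (radauCoeff α β m j)]
    simp only [symMap, add_comm (radauNode α β m j), mul_comm (radauNode α β m j)]

omit hα hβ in
theorem gridSum_mul (m : ℕ) (f g : ℝ → ℝ) :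
    gridSum α β m (fun p => f p.1 * g p.2) =
      (∑ k ∈ Finset.range (m + 1), radauCoeff α β m k * f (radauNode α β m k)) *
        ∑ k ∈ Finset.range (m + 1), radauCoeff α β m k * g (radauNode α β m k) := by
  rw [gridSum, Finset.sum_mul_sum]
  refine Finset.sum_congr rfl fun j _ => Finset.sum_congr rfl fun k _ => ?_
  ring

omit hα hβ in
theorem isLinearMean_gridSum (m : ℕ) : IsLinearMean (gridSum α β m) where
  add f g _ _ := by simp only [gridSum, mul_add, Finset.sum_add_distrib]
  const_mul c f := by
    simp only [gridSum, Finset.mul_sum]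
    exact Finset.sum_congr rfl fun j _ => Finset.sum_congr rfl fun k _ => by ring

omit hα hβ in
/-- Two functionals that are linear on continuous functions and agree on the products `x^i y^j`
agree. -/
theorem IsLinearMean.eq_of_mem_biDeg {I J : (ℝ × ℝ → ℝ) → ℝ} (hI : IsLinearMean I)
    (hJ : IsLinearMean J) {n : ℕ} {φ : ℝ × ℝ → ℝ} (hφ : Continuous φ)
    (h : ∀ i j, i ≤ n → j ≤ n →
      I (fun p => φ p * mono (i, j) p) = J fun p => φ p * mono (i, j) p)
    {H : ℝ × ℝ → ℝ} (hH : H ∈ biDeg n) :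
    I (fun p => φ p * H p) = J fun p => φ p * H p := by
  -- Continuity is carried through the induction because additivity is available only for continuous
  -- functions.
  refine (show Continuous H ∧ _ from ?_).2
  induction hH using Submodule.span_induction with
  | mem x hx =>
    obtain ⟨e, ⟨he1, he2⟩, rfl⟩ := hx
    exact ⟨continuous_mono e, h e.1 e.2 he1 he2⟩
  | zero =>
    refine ⟨continuous_const, ?_⟩
    have h1 := hI.const_mul 0 fun _ => 0
    have h2 := hJ.const_mul 0 fun _ => 0
    simpa using h1.trans (by simpa using h2.symm)
  | add f g _ _ hf hg =>
    refine ⟨hf.1.add hg.1, ?_⟩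
    have hf1 := hf.1
    have hg1 := hg.1
    simp only [Pi.add_apply, mul_add]
    rw [hI.add _ _ (by fun_prop) (by fun_prop), hJ.add _ _ (by fun_prop) (by fun_prop), hf.2, hg.2]
  | smul c f _ hf =>
    refine ⟨hf.1.const_smul c, ?_⟩
    simp only [Pi.smul_apply, smul_eq_mul, mul_left_comm _ c]
    rw [hI.const_mul, hJ.const_mul, hf.2]

/-- Both sides factor on monomials, and the Radau rule is exact in each variable. -/
theorem prodMean_eq_gridSum {m : ℕ} {H : ℝ × ℝ → ℝ} (hH : H ∈ biDeg (2 * m)) :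
    prodMean α β H = gridSum α β m H := by
  have key := IsLinearMean.eq_of_mem_biDeg (isLinearMean_prodMean hα hβ)
    (isLinearMean_gridSum (α := α) (β := β) m) (φ := fun _ => 1) continuous_const ?_ hH
  · simpa only [one_mul] using key
  · intro i j hi hj
    have h : ∀ i ≤ 2 * m, jacMean α β (fun t => t ^ i) =
        ∑ k ∈ Finset.range (m + 1), radauCoeff α β m k * radauNode α β m k ^ i := fun i hi => by
      have := jacInt_eq_radau hα hβ (m := m) (f := X ^ i) (by rwa [natDegree_X_pow])
      rw [← jacMean_eval] at this
      simpa only [eval_pow, eval_X] using this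
    simp only [one_mul, mono]
    rw [prodMean_mul α β (fun t => t ^ i) (fun t => t ^ j),
      gridSum_mul m (fun t => t ^ i) (fun t => t ^ j), h i hi, h j hj]

/-- The cubature rule is exact for polynomials of degree at most `4 m`. -/
theorem nodeSum_mono {m a b : ℕ} (hab : a + b ≤ 4 * m) :
    nodeSum α β m (mono (a, b)) = sqMean α β (mono (a, b)) := by
  rcases Nat.even_or_odd' (a + b) with ⟨n, hn | hn⟩
  -- Symmetrization halves the degree: `2n ≤ 4m` gives degree at most `n ≤ 2m` in each variable.
  · obtain ⟨g, hg, hgp⟩ := exists_mono_add_swap_of_even hn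
    rw [sqMean_eq_triMean hα hβ (continuous_mono _) hgp, triMean_eq_prodMean,
      prodMean_eq_gridSum hα hβ (m := m) (biDeg_le (by lia) hg), nodeSum_eq_gridSum hα hβ _ hgp]
    intro p
    rw [mono_neg, hn, pow_mul]
    simp
  · have hodd : ∀ p, mono (a, b) (-p) = -mono (a, b) p := fun p => by
      rw [mono_neg, hn, pow_succ, pow_mul]
      simp
    rw [nodeSum_eq_zero_of_odd hodd, sqMean_eq_zero_of_odd hα hβ hodd]

end

/-! ### Orthogonality of the symmetrized products -/

theorem IsLinearMean.symm_mul_symm {I : (ℝ × ℝ → ℝ) → ℝ} (hI : IsLinearMean I) {J : ℝ[X] → ℝ}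
    (hIJ : ∀ f g : ℝ[X], I (fun p => f.eval p.1 * g.eval p.2) = J f * J g) (A C B D : ℝ[X]) :
    I (fun p => (A.eval p.1 * C.eval p.2 + A.eval p.2 * C.eval p.1) *
      (B.eval p.1 * D.eval p.2 + B.eval p.2 * D.eval p.1)) =
      2 * (J (A * B) * J (C * D) + J (A * D) * J (C * B)) := by
  have e : ∀ p : ℝ × ℝ, (A.eval p.1 * C.eval p.2 + A.eval p.2 * C.eval p.1) *
      (B.eval p.1 * D.eval p.2 + B.eval p.2 * D.eval p.1) =
      (((A * B).eval p.1 * (C * D).eval p.2 + (A * D).eval p.1 * (C * B).eval p.2) +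
        (C * B).eval p.1 * (A * D).eval p.2) + (C * D).eval p.1 * (A * B).eval p.2 := fun p => by
    simp only [eval_mul]; ring
  have hc : ∀ f g : ℝ[X], Continuous fun p : ℝ × ℝ => f.eval p.1 * g.eval p.2 := fun f g =>
    (f.continuous.comp continuous_fst).mul (g.continuous.comp continuous_snd)
  simp only [e]
  rw [hI.add _ _ ?_ (hc _ _), hI.add _ _ ?_ (hc _ _), hI.add _ _ (hc _ _) (hc _ _)]
  · simp only [hIJ]
    ring
  · exact (hc _ _).add (hc _ _)
  · exact ((hc _ _).add (hc _ _)).add (hc _ _)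

/-- Orthogonality in one variable passes to symmetrized products for any product functional. It is
needed both for the Jacobi integral and for the Radau rule with weights `μ_k (1 + x_k)`. -/
theorem IsLinearMean.symm_orthogonal {I : (ℝ × ℝ → ℝ) → ℝ} (hI : IsLinearMean I) {J : ℝ[X] → ℝ}
    (hIJ : ∀ f g : ℝ[X], I (fun p => f.eval p.1 * g.eval p.2) = J f * J g) {P : ℕ → ℝ[X]}
    {h : ℕ → ℝ} {N : ℕ} (hJ : ∀ a b, a ≤ N → b ≤ N → J (P a * P b) = if a = b then h a else 0)
    {k n l r : ℕ} (hkn : k ≤ n) (hn : n ≤ N) (hlr : l ≤ r) (hr : r ≤ N) :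
    I (fun p => (((P n).eval p.1 * (P k).eval p.2 + (P n).eval p.2 * (P k).eval p.1) /
        (if k = n then 2 else Real.sqrt 2)) *
      (((P r).eval p.1 * (P l).eval p.2 + (P r).eval p.2 * (P l).eval p.1) /
        (if l = r then 2 else Real.sqrt 2))) = if k = l ∧ n = r then h k * h n else 0 := by
  have h2 : Real.sqrt 2 * Real.sqrt 2 = 2 := Real.mul_self_sqrt (by norm_num)
  have h20 : Real.sqrt 2 ≠ 0 := by positivity
  simp only [div_mul_div_comm, div_eq_inv_mul _ (_ * _ : ℝ)]
  rw [hI.const_mul, hI.symm_mul_symm hIJ, hJ n r hn hr, hJ k l (by lia) (by lia),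
    hJ n l hn (by lia), hJ k r (by lia) hr]
  by_cases h1 : k = l ∧ n = r
  · obtain ⟨rfl, rfl⟩ := h1
    simp only [if_true, and_self]
    by_cases h3 : k = n
    · subst h3
      simp only [if_true]
      ring
    · rw [if_neg h3, if_neg (Ne.symm h3), h2]
      ring
  · rw [if_neg h1]
    have h3 : (if n = r then h n else 0) * (if k = l then h k else 0) = 0 := by
      split_ifs <;> simp_all
    -- A nonzero cross term would need `n = l ≤ r = k ≤ n`, so all four indices would agree.
    have h4 : (if n = l then h n else 0) * (if k = r then h k else 0) = 0 := by
      by_cases h5 : n = l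
      · have : k ≠ r := fun h6 => h1 ⟨by lia, by lia⟩
        rw [if_neg this, mul_zero]
      · rw [if_neg h5, zero_mul]
    rw [h3, h4]
    ring

theorem triP_symMap (α β : ℝ) (k n : ℕ) (p : ℝ × ℝ) : triP α β k n (symMap p) =
    ((jac α β n).eval p.1 * (jac α β k).eval p.2 +
      (jac α β n).eval p.2 * (jac α β k).eval p.1) / (if k = n then 2 else Real.sqrt 2) := by
  rw [triP, symMap, symProd_add_mul]

theorem triMean_triP_mul_triP {α β : ℝ} (hα : -1 < α) (hβ : -1 < β) {k n l r : ℕ} (hkn : k ≤ n)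
    (hlr : l ≤ r) : triMean α β (fun p => triP α β k n p * triP α β l r p) =
      if k = l ∧ n = r then 1 else 0 := by
  rw [triMean_eq_prodMean]
  simp only [triP_symMap]
  rw [(isLinearMean_prodMean hα hβ).symm_orthogonal (J := jacInt hα hβ) (P := jac α β)
    (h := fun _ => 1) (N := max n r) 
    (fun f g => prodMean_mul α β (fun t => f.eval t) fun t => g.eval t)
    (fun a b _ _ => jacInt_jac_mul_jac hα hβ a b) hkn (le_max_left _ _) hlr (le_max_right _ _)]
  simp only [mul_one]

/-- The Gauss-Radau rule with the weights `μ_k (1 + x_k)`. -/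
def modRadau (α β : ℝ) (m : ℕ) (f : ℝ[X]) : ℝ :=
  ∑ i ∈ Finset.range (m + 1), radauCoeff α β m i * (1 + radauNode α β m i) *
    f.eval (radauNode α β m i)

/-- The product of two Gauss-Radau rules with the weights `μ_k (1 + x_k)`. -/
def modGridSum (α β : ℝ) (m : ℕ) (H : ℝ × ℝ → ℝ) : ℝ :=
  gridSum α β m fun p => (1 + p.1) * (1 + p.2) * H p

theorem isLinearMean_modGridSum (α β : ℝ) (m : ℕ) : IsLinearMean (modGridSum α β m) where
  add f g hf hg := by
    simp only [modGridSum, mul_add]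
    exact (isLinearMean_gridSum m).add _ _ (by fun_prop) (by fun_prop)
  const_mul c f := by
    simp only [modGridSum, mul_left_comm _ c]
    exact (isLinearMean_gridSum m).const_mul _ _

theorem modGridSum_mul (α β : ℝ) (m : ℕ) (f g : ℝ[X]) :
    modGridSum α β m (fun p => f.eval p.1 * g.eval p.2) =
      modRadau α β m f * modRadau α β m g := by
  have := gridSum_mul (α := α) (β := β) m (fun t => (1 + t) * f.eval t) fun t => (1 + t) * g.eval t
  simp only [modGridSum, modRadau, mul_assoc]
  simp only [mul_assoc] at this
  rw [← this]
  congr 1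
  funext p
  ring

section
variable {α β : ℝ} (hα : -1 < α) (hβ : -1 < β)
include hα hβ

theorem modGridSum_triP_mul_triP {m k l : ℕ} (hk : k ≤ m) (hl : l ≤ m) :
    modGridSum α β m (fun p => triP α (β + 1) k m (symMap p) * triP α (β + 1) l m (symMap p)) =
      if k = l then hHat α β m k * hHat α β m m else 0 := by
  simp only [triP_symMap]
  rw [(isLinearMean_modGridSum α β m).symm_orthogonal (J := modRadau α β m) (P := jac α (β + 1))
    (h := hHat α β m) (N := m) (modGridSum_mul α β m) _ hk le_rfl hl le_rfl]
  · simp only [and_true]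
  · intro a b ha hb
    simpa only [modRadau, eval_mul] using radau_jac_mul_jac hα hβ ha hb

/-- Each of the two products in `P_{k,m}` contains `p_m` in one variable, and that factor
annihilates all powers below `m`. -/
theorem modGridSum_triP_mul_of_mem_biDeg {m k n : ℕ} (hn : n < m) {H : ℝ × ℝ → ℝ}
    (hH : H ∈ biDeg n) :
    modGridSum α β m (fun p => triP α (β + 1) k m (symMap p) * H p) = 0 := by
  have hzero : IsLinearMean fun _ => 0 := ⟨fun _ _ _ _ => by simp, fun _ _ => by simp⟩
  refine (isLinearMean_modGridSum α β m).eq_of_mem_biDeg hzero ?_ ?_ hH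
  · simp only [triP_symMap]
    have h1 := (jac α (β + 1) m).continuous
    have h2 := (jac α (β + 1) k).continuous
    exact (((h1.comp continuous_fst).mul (h2.comp continuous_snd)).add
      ((h1.comp continuous_snd).mul (h2.comp continuous_fst))).div_const _
  · intro i j hi hj
    have key : ∀ i ≤ n, modRadau α β m (jac α (β + 1) m * X ^ i) = 0 := fun i hi => by
      simpa only [modRadau, eval_mul] using radau_jac_mul_of_lt hα hβ (f := X ^ i) (le_refl m)
        (by rw [degree_X_pow]; exact_mod_cast (by lia))
    have e : ∀ p : ℝ × ℝ, triP α (β + 1) k m (symMap p) * mono (i, j) p =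
        (if k = m then 2 else Real.sqrt 2)⁻¹ *
          ((jac α (β + 1) m * X ^ i).eval p.1 * (jac α (β + 1) k * X ^ j).eval p.2 +
          (jac α (β + 1) k * X ^ i).eval p.1 * (jac α (β + 1) m * X ^ j).eval p.2) := fun p => by
      rw [triP_symMap, div_eq_inv_mul]
      simp only [mono, eval_mul, eval_pow, eval_X]
      ring
    have hc : ∀ f g : ℝ[X], Continuous fun p : ℝ × ℝ => f.eval p.1 * g.eval p.2 := fun f g =>
      (f.continuous.comp continuous_fst).mul (g.continuous.comp continuous_snd)
    simp only [e]
    rw [(isLinearMean_modGridSum α β m).const_mul,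
      (isLinearMean_modGridSum α β m).add _ _ (hc _ _) (hc _ _), modGridSum_mul, modGridSum_mul,
      key i hi, key j hj]
    ring

omit hα hβ in
theorem oneQ_neg (m k : ℕ) (p : ℝ × ℝ) : oneQ α β m k (-p) = -oneQ α β m k p := by
  rw [oneQ, oneQ, toTri_neg]
  simp only [Prod.fst_neg, Prod.snd_neg]
  ring

omit hα hβ in
theorem oneQ_swap (m k : ℕ) (p : ℝ × ℝ) : oneQ α β m k p.swap = oneQ α β m k p := by
  rw [oneQ, oneQ, toTri_swap]
  simp only [Prod.fst_swap, Prod.snd_swap]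
  ring

/-- The factor `(x_1 + x_2)^2 = 1 + u + v` is `(1 + x)(1 + y)` on the grid and supplies the modified
weights. -/
theorem nodeSum_oneQ_mul_oneQ {m k l : ℕ} (hk : k ≤ m) (hl : l ≤ m) :
    nodeSum α β m (fun p => oneQ α β m k p * oneQ α β m l p) =
      if k = l then aConst α β ^ 2 * hHat α β m k * hHat α β m m else 0 := by
  rw [nodeSum_eq_gridSum hα hβ (h := fun q => aConst α β ^ 2 * ((1 + q.1 + q.2) *
    (triP α (β + 1) k m q * triP α (β + 1) l m q)))]
  · rw [(isLinearMean_gridSum m).const_mul]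
    have h := modGridSum_triP_mul_triP hα hβ hk hl
    have e : ∀ p : ℝ × ℝ, 1 + (symMap p).1 + (symMap p).2 = (1 + p.1) * (1 + p.2) := fun p => by
      simp only [symMap]; ring
    rw [modGridSum] at h
    simp only [e, h]
    split_ifs <;> ring
  · intro p
    rw [oneQ_neg, oneQ_neg, neg_mul_neg]
  · intro p
    simp only [oneQ_swap]
    simp only [oneQ]
    have e : 1 + (toTri p).1 + (toTri p).2 = (p.1 + p.2) ^ 2 := by simp only [toTri]; ring
    rw [e]
    ring

/-- `Q_k` is odd, so only monomials of odd degree `2n + 1` matter. Their symmetrization supplies a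
second factor `x_1 + x_2` and leaves degree at most `n < m` in each grid variable. -/
theorem nodeSum_mono_mul_oneQ {m k a b : ℕ} (hab : a + b ≤ 2 * m) :
    nodeSum α β m (fun p => mono (a, b) p * oneQ α β m k p) = 0 := by
  rcases Nat.even_or_odd' (a + b) with ⟨n, hn | hn⟩
  · refine nodeSum_eq_zero_of_odd fun p => ?_
    rw [mono_neg, oneQ_neg, hn, pow_mul]
    simp
  · obtain ⟨g, hg, hgp⟩ := exists_mono_add_swap_of_odd hn
    rw [nodeSum_eq_gridSum hα hβ (h := fun q => aConst α β / 2 * ((1 + q.1 + q.2) *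
      (triP α (β + 1) k m q * g q)))]
    · rw [(isLinearMean_gridSum m).const_mul]
      have h := modGridSum_triP_mul_of_mem_biDeg hα hβ (m := m) (k := k) (by lia : n < m) hg
      have e : ∀ p : ℝ × ℝ, 1 + (symMap p).1 + (symMap p).2 = (1 + p.1) * (1 + p.2) := fun p => by
        simp only [symMap]; ring
      rw [modGridSum] at h
      simp only [e, h, mul_zero]
    · intro p
      rw [mono_neg, oneQ_neg, hn, pow_succ, pow_mul]
      simp
    · intro p
      rw [oneQ_swap, ← add_mul, hgp, oneQ]
      have e : 1 + (toTri p).1 + (toTri p).2 = (p.1 + p.2) ^ 2 := by simp only [toTri]; ring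
      rw [e]
      ring

end

/-! ### Polynomials of bounded total degree and their reproducing kernels -/

theorem mem_monoIdx {N : ℕ} {e : ℕ × ℕ} : e ∈ monoIdx N ↔ e.1 + e.2 < N := by
  simp only [monoIdx, Finset.mem_filter, Finset.mem_product, Finset.mem_range]
  lia

theorem mem_polyLT_iff {N : ℕ} {f : ℝ × ℝ → ℝ} :
    f ∈ polyLT N ↔ ∃ c : monoIdx N → ℝ, ∀ p, f p = ∑ e, c e * mono e p := by
  have h : mono '' (monoIdx N : Set (ℕ × ℕ)) = Set.range fun e : monoIdx N => mono e := by
    ext g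
    simp
  rw [polyLT, h, Submodule.mem_span_range_iff_exists_fun]
  refine exists_congr fun c => ?_
  rw [funext_iff]
  refine forall_congr' fun p => ?_
  rw [Finset.sum_apply, eq_comm]
  simp only [Pi.smul_apply, smul_eq_mul]

theorem monoIdx_succ (N : ℕ) :
    monoIdx (N + 1) = monoIdx N ∪ Finset.HasAntidiagonal.antidiagonal N := by
  ext e
  simp only [Finset.mem_union, mem_monoIdx, Finset.HasAntidiagonal.mem_antidiagonal]
  lia

theorem disjoint_monoIdx_antidiagonal (N : ℕ) :
    Disjoint (monoIdx N) (Finset.HasAntidiagonal.antidiagonal N) := by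
  rw [Finset.disjoint_left]
  intro e he he'
  rw [mem_monoIdx] at he
  rw [Finset.HasAntidiagonal.mem_antidiagonal] at he'
  lia

theorem two_mul_card_monoIdx (N : ℕ) : 2 * (monoIdx N).card = N * (N + 1) := by
  induction N with
  | zero => rfl
  | succ N ih =>
    rw [monoIdx_succ, Finset.card_union_of_disjoint (disjoint_monoIdx_antidiagonal N),
      Finset.Nat.card_antidiagonal, mul_add, ih]
    ring

theorem mono_mem_polyLT {N : ℕ} {e : ℕ × ℕ} (he : e.1 + e.2 < N) : mono e ∈ polyLT N :=
  Submodule.subset_span ⟨e, mem_monoIdx.2 he, rfl⟩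

theorem polyLT_le {N M : ℕ} (h : N ≤ M) : polyLT N ≤ polyLT M :=
  Submodule.span_mono (Set.image_mono fun _ he =>
    mem_monoIdx.2 ((mem_monoIdx.1 he).trans_le h))

theorem mono_mul_mem_polyLT {N : ℕ} (e : ℕ × ℕ) {f : ℝ × ℝ → ℝ} (hf : f ∈ polyLT N) :
    (fun p => mono e p * f p) ∈ polyLT (N + (e.1 + e.2)) := by
  induction hf using Submodule.span_induction with
  | mem x hx =>
    obtain ⟨d, hd, rfl⟩ := hx
    have hd' := mem_monoIdx.1 hd
    convert mono_mem_polyLT (N := N + (e.1 + e.2)) (e := (e.1 + d.1, e.2 + d.2)) (by simp only; lia)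
      using 1
    funext p
    simp only [mono, pow_add]
    ring
  | zero =>
    simp only [Pi.zero_apply, mul_zero]
    exact (polyLT _).zero_mem
  | add f g _ _ hf hg =>
    convert (polyLT _).add_mem hf hg using 1
    funext p
    simp only [Pi.add_apply]
    ring
  | smul c f _ hf =>
    convert (polyLT _).smul_mem c hf using 1
    funext p
    simp only [Pi.smul_apply, smul_eq_mul]
    ring

/-- Coefficients are compared in `y` for fixed `x`, and the results in `x`; each variable runs over
an infinite set. -/
theorem sum_mul_mono_injective {N : ℕ} {c : monoIdx N → ℝ}
    (h : ∀ p ∈ openSquare, ∑ e, c e * mono e p = 0) : c = 0 := by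
  have hinf : (Set.Ioo (-1 : ℝ) 1).Infinite := Set.Ioo_infinite (by norm_num)
  have h1 : ∀ x ∈ Set.Ioo (-1 : ℝ) 1, ∀ j : ℕ,
      ∑ e : monoIdx N, (if j = e.1.2 then c e * x ^ e.1.1 else 0) = 0 := by
    intro x hx j
    have hP : ∑ e : monoIdx N, C (c e * x ^ e.1.1) * (X : ℝ[X]) ^ e.1.2 = 0 := by
      refine eq_zero_of_infinite_isRoot _ (hinf.mono fun y hy => ?_)
      have := h (x, y) ⟨hx, hy⟩
      simpa [IsRoot, eval_finsetSum, mono, mul_assoc] using this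
    have := congrArg (fun q => q.coeff j) hP
    simpa only [finsetSum_coeff, coeff_C_mul_X_pow, coeff_zero] using this
  funext d
  have hP : ∑ e : monoIdx N, C (if d.1.2 = e.1.2 then c e else 0) * (X : ℝ[X]) ^ e.1.1 = 0 := by
    refine eq_zero_of_infinite_isRoot _ (hinf.mono fun x hx => ?_)
    have := h1 x hx d.1.2
    simpa [IsRoot, eval_finsetSum, apply_ite, ite_mul] using this
  have h2 := congrArg (fun q => q.coeff d.1.1) hP
  simp only [finsetSum_coeff, coeff_C_mul_X_pow, coeff_zero] at h2
  rw [Finset.sum_eq_single d] at h2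
  · simpa using h2
  · intro e _ hne
    by_cases h3 : d.1.1 = e.1.1
    · rw [if_pos h3, if_neg fun h4 => hne (Subtype.ext (Prod.ext h3.symm h4.symm))]
    · rw [if_neg h3]
  · simp

/-- A null vector would be a polynomial whose square has mean zero. Invertibility makes the inverse
in `polyKernel` a genuine one. -/
theorem det_gram_sqMean_ne_zero {α β : ℝ} (hα : -1 < α) (hβ : -1 < β) (N : ℕ) :
    (gram (sqMean α β) N).det ≠ 0 := by
  intro hdet
  obtain ⟨c, hc, hGc⟩ := Matrix.exists_mulVec_eq_zero_iff.2 hdet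
  have hcont : Continuous fun p => ∑ e : monoIdx N, c e * mono e p :=
    continuous_finsetSum _ fun e _ => continuous_const.mul (continuous_mono e)
  have h0 : sqMean α β (fun p => (∑ e : monoIdx N, c e * mono e p) *
      ∑ e : monoIdx N, c e * mono e p) = 0 := by
    rw [(isLinearMean_sqMean hα hβ).sum_mul_sum _ _ _ _ (fun e : monoIdx N => mono e)
      (fun e : monoIdx N => mono e) (fun e => continuous_mono e) (fun e => continuous_mono e)]
    refine Finset.sum_eq_zero fun d _ => ?_
    have h1 := congrFun hGc d
    simp only [Matrix.mulVec, dotProduct, gram, Matrix.of_apply, Pi.zero_apply] at h1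
    rw [← mul_zero (c d), ← h1, Finset.mul_sum]
    exact Finset.sum_congr rfl fun e _ => by ring
  refine hc (sum_mul_mono_injective fun p hp => ?_)
  by_contra hne
  exact (sqMean_pos hα hβ (hcont.mul hcont) (fun _ => mul_self_nonneg _) hp
    (mul_self_ne_zero.2 hne)).ne' h0

/-- If the rows of the square matrix `A` hold the coefficients of the orthonormal family, then `A G
Aᵀ = 1`, hence `G⁻¹ = Aᵀ A`. -/
theorem polyKernel_eq_sum_of_orthonormal {I : (ℝ × ℝ → ℝ) → ℝ} (hI : IsLinearMean I) {N : ℕ}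
    {φ : monoIdx N → ℝ × ℝ → ℝ} (hφ : ∀ d, φ d ∈ polyLT N)
    (horth : ∀ d e, I (fun p => φ d p * φ e p) = if d = e then 1 else 0) (x y : ℝ × ℝ) :
    polyKernel I N x y = ∑ d, φ d x * φ d y := by
  choose A hA using fun d => mem_polyLT_iff.1 (hφ d)
  have h1 : Matrix.of A * gram I N * (Matrix.of A).transpose = 1 := by
    ext d e
    have h := horth d e
    simp only [hA] at h
    rw [hI.sum_mul_sum _ _ _ _ (fun e : monoIdx N => mono e)
      (fun e : monoIdx N => mono e) (fun e => continuous_mono e) (fun e => continuous_mono e)] at h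
    rw [Matrix.one_apply, ← h]
    simp only [Matrix.mul_apply, gram, Matrix.of_apply, Matrix.transpose_apply, Finset.sum_mul]
    rw [Finset.sum_comm]
    exact Finset.sum_congr rfl fun i _ => Finset.sum_congr rfl fun j _ => by ring
  have h2 : (gram I N)⁻¹ = (Matrix.of A).transpose * Matrix.of A := by
    refine Matrix.inv_eq_left_inv ?_
    rw [Matrix.mul_assoc]
    exact mul_eq_one_comm.1 h1
  rw [polyKernel, h2]
  simp only [hA, Matrix.mul_apply, Matrix.of_apply, Matrix.transpose_apply, Finset.sum_mul,
    Finset.mul_sum]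
  rw [Finset.sum_comm_cycle]
  refine Finset.sum_congr rfl fun d _ => ?_
  rw [Finset.sum_comm]
  exact Finset.sum_congr rfl fun i _ => Finset.sum_congr rfl fun j _ => by ring

/-! ### The kernels on the parabolic triangle -/

/-- The cross terms of the product of power sums are `v^j` times a power sum. The recursion proves
this also where `u, v` do not come from real `x, y`. -/
theorem powSum_mul_powSum (u v : ℝ) (j c : ℕ) :
    powSum u v (j + c) * powSum u v j = powSum u v (j + c + j) + v ^ j * powSum u v c := by
  induction j using Nat.twoStepInduction generalizing c with
  | zero => simp only [powSum, zero_add, pow_zero, add_zero]; ring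
  | one =>
    rw [show 1 + c + 1 = c + 2 by ring, add_comm 1 c]
    simp only [powSum]; ring
  | more j ih ih' =>
    have h1 := ih (c + 2)
    have h2 := ih' (c + 1)
    rw [show j + (c + 2) = j + 2 + c by ring] at h1
    rw [show j + 1 + (c + 1) = j + 2 + c by ring] at h2
    rw [show j + 2 + c + (j + 2) = (j + 2 + c + j) + 2 by ring]
    simp only [powSum] at h1 ⊢
    rw [show j + 2 + c + (j + 1) = j + 2 + c + j + 1 by ring] at h2
    linear_combination u * h2 - v * h1

theorem powSum_mem_polyLT (c : ℕ) : (fun p : ℝ × ℝ => powSum p.1 p.2 c) ∈ polyLT (c + 1) := by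
  induction c using Nat.twoStepInduction with
  | zero =>
    convert (polyLT 1).smul_mem 2 (mono_mem_polyLT (e := (0, 0)) one_pos) using 1
    funext p
    simp [powSum, mono]
  | one =>
    convert mono_mem_polyLT (N := 2) (e := (1, 0)) (by norm_num) using 1
    funext p
    simp [powSum, mono]
  | more c ih ih' =>
    have h1 := mono_mul_mem_polyLT (1, 0) ih'
    have h2 := polyLT_le (by simp only; lia : c + 1 + ((0, 1) : ℕ × ℕ).1 + ((0, 1) : ℕ × ℕ).2 ≤ c + 2 + 1)
      (mono_mul_mem_polyLT (0, 1) ih)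
    convert (polyLT (c + 2 + 1)).sub_mem h1 h2 using 1
    funext p
    simp [powSum, mono]

/-- For `j ≤ i` this is `v^j` times a power sum of index `i - j`, so its total degree in `u, v` is
at most `j + (i - j) = i`. -/
theorem symProd_X_pow_mem_polyLT {n i j : ℕ} (hi : i ≤ n) (hj : j ≤ n) :
    (fun p : ℝ × ℝ => powSum p.1 p.2 i * powSum p.1 p.2 j - powSum p.1 p.2 (i + j)) ∈
      polyLT (n + 1) := by
  wlog hij : j ≤ i generalizing i j
  · simpa only [mul_comm (powSum _ _ j), add_comm j] using this hj hi (by lia)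
  obtain ⟨c, rfl⟩ : ∃ c, i = j + c := ⟨i - j, by lia⟩
  simp only [powSum_mul_powSum, add_sub_cancel_left]
  have h := polyLT_le (by simp only; lia :
    c + 1 + (((0, j) : ℕ × ℕ).1 + ((0, j) : ℕ × ℕ).2) ≤ n + 1)
    (mono_mul_mem_polyLT (0, j) (powSum_mem_polyLT c))
  simpa only [mono, pow_zero, one_mul] using h

theorem symSum_eq_sum_range {q : ℝ[X]} {n : ℕ} (hq : q.natDegree < n) (u v : ℝ) :
    symSum q u v = ∑ i ∈ Finset.range n, q.coeff i * powSum u v i :=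
  sum_over_range' q (f := fun i a => a * powSum u v i) (fun _ => zero_mul _) n hq

theorem symSum_mul {q r : ℝ[X]} {n k : ℕ} (hq : q.natDegree < n) (hr : r.natDegree < k)
    (u v : ℝ) : symSum (q * r) u v = ∑ i ∈ Finset.range n, ∑ j ∈ Finset.range k,
      q.coeff i * r.coeff j * powSum u v (i + j) := by
  have hadd : ∀ (s : Finset ℕ) (f : ℕ → ℝ[X]),
      symSum (∑ i ∈ s, f i) u v = ∑ i ∈ s, symSum (f i) u v := by
    intro s f
    classical
    induction s using Finset.induction_on with
    | empty => simp [symSum]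
    | insert a s ha ih =>
      rw [Finset.sum_insert ha, Finset.sum_insert ha, ← ih]
      exact sum_add_index _ _ _ (fun _ => zero_mul _) fun _ _ _ => add_mul _ _ _
  conv_lhs => rw [q.as_sum_range' n hq, r.as_sum_range' k hr, Finset.sum_mul_sum]
  rw [hadd]
  refine Finset.sum_congr rfl fun i _ => ?_
  rw [hadd]
  refine Finset.sum_congr rfl fun j _ => ?_
  rw [monomial_mul_monomial]
  exact sum_monomial_index _ _ (zero_mul _)

theorem symProd_mem_polyLT {q r : ℝ[X]} {n : ℕ} (hq : q.natDegree ≤ n) (hr : r.natDegree ≤ n) :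
    (fun p : ℝ × ℝ => symProd q r p.1 p.2) ∈ polyLT (n + 1) := by
  have h : (fun p : ℝ × ℝ => symProd q r p.1 p.2) = ∑ i ∈ Finset.range (n + 1),
      ∑ j ∈ Finset.range (n + 1), (q.coeff i * r.coeff j) •
        fun p : ℝ × ℝ => powSum p.1 p.2 i * powSum p.1 p.2 j - powSum p.1 p.2 (i + j) := by
    funext p
    simp only [Finset.sum_apply, Pi.smul_apply, smul_eq_mul]
    rw [symProd, symSum_mul (Nat.lt_succ_of_le hq) (Nat.lt_succ_of_le hr),
      symSum_eq_sum_range (Nat.lt_succ_of_le hq), symSum_eq_sum_range (Nat.lt_succ_of_le hr),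
      Finset.sum_mul_sum, ← Finset.sum_sub_distrib]
    refine Finset.sum_congr rfl fun i _ => ?_
    rw [← Finset.sum_sub_distrib]
    exact Finset.sum_congr rfl fun j _ => by ring
  rw [h]
  refine Submodule.sum_mem _ fun i hi => Submodule.sum_mem _ fun j hj =>
    Submodule.smul_mem _ _ (symProd_X_pow_mem_polyLT ?_ ?_)
  · exact Nat.lt_succ_iff.1 (Finset.mem_range.1 hi)
  · exact Nat.lt_succ_iff.1 (Finset.mem_range.1 hj)

/-- An exponent pair `d` labels `P_{k,n}` with `k = d.1` and `n = d.1 + d.2`, so the orthonormal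
family has the same index set as the monomials. -/
theorem polyKernel_triMean {α β : ℝ} (hα : -1 < α) (hβ : -1 < β) (N : ℕ) (x y : ℝ × ℝ) :
    polyKernel (triMean α β) N x y =
      ∑ d ∈ monoIdx N, triP α β d.1 (d.1 + d.2) x * triP α β d.1 (d.1 + d.2) y := by
  rw [polyKernel_eq_sum_of_orthonormal (isLinearMean_triMean hα hβ)
    (φ := fun d : monoIdx N => triP α β d.1.1 (d.1.1 + d.1.2))]
  · exact Finset.sum_coe_sort (monoIdx N)
      fun d => triP α β d.1 (d.1 + d.2) x * triP α β d.1 (d.1 + d.2) y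
  · rintro ⟨d, hd⟩
    rw [mem_monoIdx] at hd
    have h := polyLT_le (by lia : d.1 + d.2 + 1 ≤ N) (symProd_mem_polyLT
      (natDegree_jac hα hβ (d.1 + d.2)).le
      ((natDegree_jac hα hβ d.1).le.trans (Nat.le_add_right _ d.2)))
    convert (polyLT N).smul_mem (if d.1 = d.1 + d.2 then 2 else Real.sqrt 2)⁻¹ h using 1
    funext p
    simp only [triP, Pi.smul_apply, smul_eq_mul, div_eq_inv_mul]
  · rintro ⟨d, hd⟩ ⟨e, he⟩
    rw [triMean_triP_mul_triP hα hβ (Nat.le_add_right _ _) (Nat.le_add_right _ _)]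
    refine if_congr ?_ rfl rfl
    rw [Subtype.mk.injEq, Prod.ext_iff]
    simp only
    constructor <;> rintro ⟨h1, h2⟩ <;> exact ⟨h1, by lia⟩

theorem polyKernel_triMean_sub {α β : ℝ} (hα : -1 < α) (hβ : -1 < β) (m : ℕ) (x y : ℝ × ℝ) :
    polyKernel (triMean α β) (m + 1) x y - polyKernel (triMean α β) m x y =
      ∑ k ∈ Finset.range (m + 1), triP α β k m x * triP α β k m y := by
  rw [polyKernel_triMean hα hβ, polyKernel_triMean hα hβ, monoIdx_succ,
    Finset.sum_union (disjoint_monoIdx_antidiagonal m),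
    add_sub_cancel_left, Finset.Nat.sum_antidiagonal_eq_sum_range_succ_mk]
  refine Finset.sum_congr rfl fun k hk => ?_
  rw [Nat.add_sub_cancel' (Nat.lt_succ_iff.1 (Finset.mem_range.1 hk))]

/-! ### Interpolation at the nodes -/

/-- Index set of a basis of the interpolation space. -/
abbrev BasisIdx (m : ℕ) : Type := monoIdx (2 * m + 1) ⊕ Fin (m + 1)

/-- A basis of the interpolation space. -/
def basisFun (α β : ℝ) (m : ℕ) : BasisIdx m → ℝ × ℝ → ℝ :=
  Sum.elim (fun d => mono d) fun k => oneQ α β m k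

/-- The coefficients of `coeffKernel` in the basis `basisFun`. -/
def coeffMatrix (α β : ℝ) (m : ℕ) (b : ℕ → ℝ) : Matrix (BasisIdx m) (BasisIdx m) ℝ :=
  Matrix.fromBlocks (gram (sqMean α β) (2 * m + 1))⁻¹ 0 0 (Matrix.diagonal fun k => b k)

/-- The indices of the nodes, without repetition. -/
def nodeIdx (m : ℕ) : Finset (Σ _ : ℕ, Σ _ : ℕ, Fin 4) :=
  (Finset.range (m + 1)).sigma fun k => (Finset.range (k + 1)).sigma fun j =>
    if j = 0 then {0, 2} else Finset.univ

open Classical in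
/-- The finite set of the nodes. -/
def nodeFinset (α β : ℝ) (m : ℕ) : Finset (ℝ × ℝ) :=
  (nodeIdx m).image fun τ => node α β m τ.2.1 τ.1 τ.2.2

open Classical in
/-- The total weight of a point in the cubature rule. -/
def pointWeight (α β : ℝ) (m : ℕ) (p : ℝ × ℝ) : ℝ :=
  nodeSum α β m fun q => if q = p then 1 else 0

/-- The values of the basis functions at the nodes. -/
def evalMatrix (α β : ℝ) (m : ℕ) : Matrix (nodeFinset α β m) (BasisIdx m) ℝ :=
  Matrix.of fun p i => basisFun α β m i p

/-- The coefficients of the interpolant in terms of the values at the nodes. -/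
def interpMatrix (α β : ℝ) (m : ℕ) (b : ℕ → ℝ) : Matrix (BasisIdx m) (nodeFinset α β m) ℝ :=
  coeffMatrix α β m b * Matrix.of fun i (p : nodeFinset α β m) => pointWeight α β m p * basisFun α β m i p

theorem card_nodeIdx (m : ℕ) : (nodeIdx m).card = 2 * (m + 1) ^ 2 := by
  have h : ∀ k, ((Finset.range (k + 1)).sigma fun j =>
      if j = 0 then ({0, 2} : Finset (Fin 4)) else Finset.univ).card = 2 + 4 * k := by
    intro k
    rw [Finset.card_sigma, Finset.sum_range_succ', if_pos rfl]
    have : ∀ j : ℕ, (if j + 1 = 0 then ({0, 2} : Finset (Fin 4)) else Finset.univ).card = 4 :=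
      fun j => by rw [if_neg (Nat.succ_ne_zero j)]; rfl
    rw [Finset.sum_congr rfl fun j _ => this j, Finset.sum_const, Finset.card_range, smul_eq_mul]
    have h2 : ({0, 2} : Finset (Fin 4)).card = 2 := rfl
    rw [h2]
    ring
  rw [nodeIdx, Finset.card_sigma, Finset.sum_congr rfl fun k _ => h k]
  induction m with
  | zero => rfl
  | succ m ih => rw [Finset.sum_range_succ, ih]; ring

theorem card_nodeFinset_le (α β : ℝ) (m : ℕ) :
    (nodeFinset α β m).card ≤ 2 * (m + 1) ^ 2 :=
  Finset.card_image_le.trans (card_nodeIdx m).le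

/-- The count is `(2m + 1)(m + 1) + (m + 1)`, matching the number of node indices. -/
theorem card_basisIdx (m : ℕ) : Fintype.card (BasisIdx m) = 2 * (m + 1) ^ 2 := by
  rw [Fintype.card_sum, Fintype.card_coe, Fintype.card_fin]
  have := two_mul_card_monoIdx (2 * m + 1)
  nlinarith

/-- The dropped indices lose no points: for `j = 0` the angle is `0`, so the two cosines agree and
the nodes coincide in pairs. -/
theorem node_mem_nodeFinset (α β : ℝ) {m j k : ℕ} (hj : j ≤ k) (hk : k ≤ m) (i : Fin 4) :
    node α β m j k i ∈ nodeFinset α β m := by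
  classical
  have key : ∀ i : Fin 4, (j = 0 → i = 0 ∨ i = 2) → node α β m j k i ∈ nodeFinset α β m := by
    intro i hi
    refine Finset.mem_image.2 ⟨⟨k, j, i⟩, ?_, rfl⟩
    simp only [nodeIdx, Finset.mem_sigma, Finset.mem_range]
    refine ⟨by lia, by lia, ?_⟩
    split_ifs with h
    · simpa using hi h
    · exact Finset.mem_univ i
  rcases Nat.eq_zero_or_pos j with rfl | hj0
  · have hθ : radauAngle α β m 0 = 0 := by rw [radauAngle, radauNode_zero, Real.arccos_one]
    have hswap : (node α β m 0 k 0).swap = node α β m 0 k 0 := by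
      have h1 : (0 - radauAngle α β m k) / 2 = -((0 + radauAngle α β m k) / 2) := by ring
      simp only [node, hθ, Matrix.cons_val_zero, Prod.swap_prod_mk]
      rw [h1, Real.cos_neg]
    obtain ⟨h1, h2, h3⟩ := node_eq α β m 0 k
    have h0 := key 0 fun _ => Or.inl rfl
    have h2' := key 2 fun _ => Or.inr rfl
    fin_cases i
    · exact h0
    · exact (h1.trans hswap) ▸ h0
    · exact h2'
    · refine (?_ : node α β m 0 k 3 = node α β m 0 k 2) ▸ h2'
      rw [h2, h3, hswap]
  · exact key i fun h => absurd h hj0.ne'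

theorem mem_nodeFinset {α β : ℝ} {m : ℕ} {p : ℝ × ℝ} :
    p ∈ nodeFinset α β m ↔ p ∈ nodeSet α β m := by
  classical
  constructor
  · intro hp
    obtain ⟨⟨k, j, i⟩, hτ, rfl⟩ := Finset.mem_image.1 hp
    simp only [nodeIdx, Finset.mem_sigma, Finset.mem_range] at hτ
    exact ⟨j, k, i, by lia, by lia, rfl⟩
  · rintro ⟨j, k, i, hj, hk, rfl⟩
    exact node_mem_nodeFinset α β hj hk i

theorem nodeSum_congr {α β : ℝ} {m : ℕ} {F G : ℝ × ℝ → ℝ}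
    (h : ∀ p ∈ nodeFinset α β m, F p = G p) : nodeSum α β m F = nodeSum α β m G := by
  refine Finset.sum_congr rfl fun k hk => Finset.sum_congr rfl fun j hj =>
    Finset.sum_congr rfl fun i _ => ?_
  rw [Finset.mem_range] at hk hj
  rw [h _ (node_mem_nodeFinset α β (by lia) (by lia) i)]

theorem nodeSum_sum {α β : ℝ} {m : ℕ} {ι : Type*} (s : Finset ι) (c : ι → ℝ)
    (F : ι → ℝ × ℝ → ℝ) :
    nodeSum α β m (fun p => ∑ i ∈ s, c i * F i p) = ∑ i ∈ s, c i * nodeSum α β m (F i) := by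
  classical
  induction s using Finset.induction_on with
  | empty => simp [nodeSum]
  | insert a s ha ih =>
    rw [Finset.sum_insert ha, ← ih]
    simp only [nodeSum, Finset.mul_sum, ← Finset.sum_add_distrib, Finset.sum_insert ha]
    refine Finset.sum_congr rfl fun k _ => Finset.sum_congr rfl fun j _ =>
      Finset.sum_congr rfl fun i _ => ?_
    rw [mul_add, ← Finset.mul_sum]
    ring

/-- Collects the repeated nodes, so that the matrices can be indexed by points. -/
theorem nodeSum_eq_sum_pointWeight (α β : ℝ) (m : ℕ) (F : ℝ × ℝ → ℝ) :
    nodeSum α β m F = ∑ p : nodeFinset α β m, pointWeight α β m p * F p := by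
  classical
  rw [Finset.sum_coe_sort (nodeFinset α β m) fun p => pointWeight α β m p * F p]
  simp only [pointWeight, mul_comm _ (F _)]
  rw [← nodeSum_sum]
  refine nodeSum_congr fun p hp => ?_
  simp [hp]

theorem interp_eq_nodeSum (α β : ℝ) (m : ℕ) (K : ℝ × ℝ → ℝ × ℝ → ℝ) (f : ℝ × ℝ → ℝ)
    (x : ℝ × ℝ) : interp α β m K f x = nodeSum α β m fun q => K x q * f q := by
  refine Finset.sum_congr rfl fun k _ => Finset.sum_congr rfl fun j _ =>
    Finset.sum_congr rfl fun i _ => ?_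
  rw [fundPoly]
  ring

theorem coeffKernel_eq_sum (α β : ℝ) (m : ℕ) (b : ℕ → ℝ) (x y : ℝ × ℝ) :
    coeffKernel α β m b x y = ∑ i, basisFun α β m i x *
      ∑ j, coeffMatrix α β m b i j * basisFun α β m j y := by
  rw [Fintype.sum_sum_type]
  simp only [Fintype.sum_sum_type, coeffMatrix, basisFun, Sum.elim_inl, Sum.elim_inr,
    Matrix.fromBlocks_apply₁₁, Matrix.fromBlocks_apply₁₂, Matrix.fromBlocks_apply₂₁,
    Matrix.fromBlocks_apply₂₂, Matrix.zero_apply, zero_mul, Finset.sum_const_zero, add_zero,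
    zero_add]
  rw [coeffKernel, polyKernel]
  congr 1
  · refine Finset.sum_congr rfl fun d _ => ?_
    rw [Finset.mul_sum]
    exact Finset.sum_congr rfl fun e _ => by ring
  · rw [← Fin.sum_univ_eq_sum_range fun k => b k * oneQ α β m k x * oneQ α β m k y]
    refine Finset.sum_congr rfl fun k _ => ?_
    rw [Finset.sum_eq_single k]
    · rw [Matrix.diagonal_apply_eq]
      ring
    · intro l _ hl
      rw [Matrix.diagonal_apply_ne' _ hl, zero_mul]
    · simp

/-- The values of a function at the nodes. -/
def nodeValues (α β : ℝ) (m : ℕ) (f : ℝ × ℝ → ℝ) : nodeFinset α β m → ℝ := fun p => f p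

theorem interp_coeffKernel (α β : ℝ) (m : ℕ) (b : ℕ → ℝ) (f : ℝ × ℝ → ℝ) (x : ℝ × ℝ) :
    interp α β m (coeffKernel α β m b) f x =
      ∑ i, basisFun α β m i x * (interpMatrix α β m b).mulVec (nodeValues α β m f) i := by
  rw [interp_eq_nodeSum, nodeSum_eq_sum_pointWeight]
  simp only [coeffKernel_eq_sum, Matrix.mulVec, dotProduct, interpMatrix, Matrix.mul_apply,
    Matrix.of_apply, nodeValues, Finset.mul_sum, Finset.sum_mul]
  rw [Finset.sum_comm]
  refine Finset.sum_congr rfl fun i _ => Finset.sum_congr rfl fun p _ =>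
    Finset.sum_congr rfl fun j _ => ?_
  ring

theorem interp_coeffKernel_node (α β : ℝ) (m : ℕ) (b : ℕ → ℝ) (f : ℝ × ℝ → ℝ)
    (p : nodeFinset α β m) : interp α β m (coeffKernel α β m b) f p =
      (evalMatrix α β m * interpMatrix α β m b).mulVec (nodeValues α β m f) p := by
  rw [interp_coeffKernel, ← Matrix.mulVec_mulVec]
  rfl

/-- Interpolation of all functions is the statement that one matrix is the right inverse of
another. -/
theorem interpolates_iff (α β : ℝ) (m : ℕ) (b : ℕ → ℝ) :
    (∀ f : ℝ × ℝ → ℝ, ∀ p ∈ nodeSet α β m, interp α β m (coeffKernel α β m b) f p = f p) ↔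
      evalMatrix α β m * interpMatrix α β m b = 1 := by
  classical
  constructor
  · intro h
    refine Matrix.ext_of_mulVec_single fun q => ?_
    -- Indicator functions of single nodes recover the columns of the matrix.
    have hq : nodeValues α β m (fun x => if x = q then 1 else 0) = Pi.single q 1 := by
      funext p
      simp only [nodeValues, Pi.single_apply, Subtype.ext_iff]
    funext p
    rw [← hq, ← interp_coeffKernel_node, h _ _ (mem_nodeFinset.1 p.2), Matrix.one_mulVec]
    rfl
  · intro h f p hp
    rw [interp_coeffKernel_node α β m b f ⟨p, mem_nodeFinset.2 hp⟩, h, Matrix.one_mulVec]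
    rfl

/-! ### The discrete Gram matrix and the inversion of the evaluation matrix -/

section
variable {α β : ℝ} (hα : -1 < α) (hβ : -1 < β)
include hα hβ

/-- The Gram matrix of the basis with respect to the cubature rule. -/
theorem nodeSum_gram (m : ℕ) :
    (Matrix.of fun i j => nodeSum α β m fun p => basisFun α β m i p * basisFun α β m j p) =
      Matrix.fromBlocks (gram (sqMean α β) (2 * m + 1)) 0 0
        (Matrix.diagonal fun k : Fin (m + 1) =>
          aConst α β ^ 2 * hHat α β m k * hHat α β m m) := by
  ext i j
  rcases i with ⟨d, hd⟩ | k <;> rcases j with ⟨e, he⟩ | l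
  · rw [mem_monoIdx] at hd he
    have h : (fun p => mono d p * mono e p) = mono (d.1 + e.1, d.2 + e.2) := by
      funext p
      simp only [mono, pow_add]
      ring
    simp only [Matrix.of_apply, basisFun, Sum.elim_inl, Matrix.fromBlocks_apply₁₁, gram, h]
    exact nodeSum_mono hα hβ (by lia)
  · rw [mem_monoIdx] at hd
    simp only [Matrix.of_apply, basisFun, Sum.elim_inl, Sum.elim_inr, Matrix.fromBlocks_apply₁₂,
      Matrix.zero_apply]
    exact nodeSum_mono_mul_oneQ hα hβ (by lia)
  · rw [mem_monoIdx] at he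
    simp only [Matrix.of_apply, basisFun, Sum.elim_inl, Sum.elim_inr, Matrix.fromBlocks_apply₂₁,
      Matrix.zero_apply, mul_comm (oneQ _ _ _ _ _)]
    exact nodeSum_mono_mul_oneQ hα hβ (by lia)
  · simp only [Matrix.of_apply, basisFun, Sum.elim_inr, Matrix.fromBlocks_apply₂₂]
    rw [nodeSum_oneQ_mul_oneQ hα hβ (by lia) (by lia), Matrix.diagonal_apply]
    exact if_congr Fin.ext_iff.symm rfl rfl

/-- The product is the coefficient matrix of the kernel times the discrete Gram matrix, and both are
block diagonal. -/
theorem interpMatrix_mul_evalMatrix (m : ℕ) (b : ℕ → ℝ) :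
    interpMatrix α β m b * evalMatrix α β m = Matrix.fromBlocks 1 0 0
      (Matrix.diagonal fun k : Fin (m + 1) =>
        b k * (aConst α β ^ 2 * hHat α β m k * hHat α β m m)) := by
  have h : (Matrix.of fun i (p : nodeFinset α β m) =>
      pointWeight α β m p * basisFun α β m i p) * evalMatrix α β m =
      Matrix.of fun i j => nodeSum α β m fun p => basisFun α β m i p * basisFun α β m j p := by
    ext i j
    simp only [Matrix.mul_apply, evalMatrix, Matrix.of_apply, nodeSum_eq_sum_pointWeight, mul_assoc]
  rw [interpMatrix, Matrix.mul_assoc, h, nodeSum_gram hα hβ, coeffMatrix,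
    Matrix.fromBlocks_multiply, Matrix.nonsing_inv_mul _
      (isUnit_iff_ne_zero.2 (det_gram_sqMean_ne_zero hα hβ _)), Matrix.diagonal_mul_diagonal]
  simp

theorem aConst_pos : 0 < aConst α β :=
  Real.sqrt_pos.2 (div_pos (triMass_pos hα hβ) (triMass_pos hα (by linarith)))

theorem oneQ_normSq_pos {m k : ℕ} (hk : k ≤ m) :
    0 < aConst α β ^ 2 * hHat α β m k * hHat α β m m :=
  mul_pos (mul_pos (pow_pos (aConst_pos hα hβ) 2) (hHat_pos hα hβ hk)) (hHat_pos hα hβ le_rfl)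

theorem interpMatrix_mul_evalMatrix_eq_one_iff (m : ℕ) (b : ℕ → ℝ) :
    interpMatrix α β m b * evalMatrix α β m = 1 ↔
      ∀ k ≤ m, b k = 1 / (aConst α β ^ 2 * hHat α β m k * hHat α β m m) := by
  rw [interpMatrix_mul_evalMatrix hα hβ, ← Matrix.fromBlocks_one, Matrix.fromBlocks_inj]
  simp only [true_and]
  rw [← Matrix.diagonal_one, Matrix.diagonal_injective.eq_iff, funext_iff]
  constructor
  · intro h k hk
    rw [eq_div_iff (oneQ_normSq_pos hα hβ hk).ne']
    exact h ⟨k, Nat.lt_succ_of_le hk⟩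
  · intro h k
    have hk : (k : ℕ) ≤ m := Nat.lt_succ_iff.1 k.2
    exact (eq_div_iff (oneQ_normSq_pos hα hβ hk).ne').1 (h k hk)

/-- A left inverse makes evaluation injective, so there are at least as many nodes as basis
functions; the index count gives the other bound. -/
theorem card_nodeFinset (m : ℕ) :
    Fintype.card (nodeFinset α β m) = Fintype.card (BasisIdx m) := by
  refine le_antisymm ?_ ?_
  · rw [card_basisIdx, Fintype.card_coe]
    exact card_nodeFinset_le α β m
  · have h1 := (interpMatrix_mul_evalMatrix_eq_one_iff hα hβ m fun k =>
      1 / (aConst α β ^ 2 * hHat α β m k * hHat α β m m)).2 fun _ _ => rfl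
    refine card_le_of_injective ℝ (evalMatrix α β m).mulVecLin fun c d hcd => ?_
    have h2 := congrArg (interpMatrix α β m fun k =>
      1 / (aConst α β ^ 2 * hHat α β m k * hHat α β m m)).mulVec hcd
    simpa only [Matrix.mulVecLin_apply, Matrix.mulVec_mulVec, h1, Matrix.one_mulVec] using h2

/-- With equal cardinalities a left inverse is the same as a right inverse. -/
theorem evalMatrix_mul_interpMatrix_eq_one_iff (m : ℕ) (b : ℕ → ℝ) :
    evalMatrix α β m * interpMatrix α β m b = 1 ↔
      ∀ k ≤ m, b k = 1 / (aConst α β ^ 2 * hHat α β m k * hHat α β m m) := by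
  rw [Matrix.mul_eq_one_comm_of_card_eq _ _ ℝ (card_nodeFinset hα hβ m),
    interpMatrix_mul_evalMatrix_eq_one_iff hα hβ]

omit hα hβ in
theorem mem_interpSpace_iff {m : ℕ} {g : ℝ × ℝ → ℝ} :
    g ∈ interpSpace α β m ↔ ∃ c : BasisIdx m → ℝ, ∀ x, g x = ∑ i, basisFun α β m i x * c i := by
  have h1 : mono '' (monoIdx (2 * m + 1) : Set (ℕ × ℕ)) =
      Set.range fun e : monoIdx (2 * m + 1) => mono e := by
    ext g
    simp
  have h2 : oneQ α β m '' Set.Iic m = Set.range fun k : Fin (m + 1) => oneQ α β m k := by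
    ext g
    constructor
    · rintro ⟨k, hk, rfl⟩
      exact ⟨⟨k, Nat.lt_succ_of_le hk⟩, rfl⟩
    · rintro ⟨k, rfl⟩
      exact ⟨k, Nat.lt_succ_iff.1 k.2, rfl⟩
  rw [interpSpace, polyLT, h1, h2, ← Submodule.span_union, ← Set.Sum.elim_range,
    Submodule.mem_span_range_iff_exists_fun]
  refine exists_congr fun c => ?_
  rw [funext_iff]
  refine forall_congr' fun p => ?_
  rw [Finset.sum_apply, eq_comm]
  simp only [Pi.smul_apply, smul_eq_mul, mul_comm (c _)]
  rfl

theorem starKernel_eq_coeffKernel (m : ℕ) (x y : ℝ × ℝ) : starKernel α β m x y =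
    coeffKernel α β m (fun k => 1 / (aConst α β ^ 2 * hHat α β m k * hHat α β m m)) x y := by
  have ha := (aConst_pos hα hβ).ne'
  have hm := (hHat_pos hα hβ (le_refl m)).ne'
  have h0 := (hHat_pos hα hβ (Nat.zero_le m)).ne'
  rw [starKernel, coeffKernel, polyKernel_triMean_sub hα (neg_one_lt_add_one hβ),
    Finset.sum_range_succ, Finset.sum_range_succ]
  have h : ∑ k ∈ Finset.range m, 1 / (aConst α β ^ 2 * hHat α β m k * hHat α β m m) *
      oneQ α β m k x * oneQ α β m k y = 1 / (hHat α β m 0 * hHat α β m m) * (x.1 + x.2) *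
      (y.1 + y.2) * ∑ k ∈ Finset.range m,
        triP α (β + 1) k m (toTri x) * triP α (β + 1) k m (toTri y) := by
    rw [Finset.mul_sum]
    refine Finset.sum_congr rfl fun k hk => ?_
    rw [Finset.mem_range] at hk
    -- For `k < m`, `ĥ_k = ĥ_0`, and the factor `a^2` in the products `Q_k Q_k` cancels.
    rw [hHat_eq hα hβ hk, ← hHat_eq hα hβ (show 0 < m by lia), oneQ, oneQ]
    field_simp
  -- What remains is `k = m`: the coefficient `1 + (ĥ_0 / ĥ_m - 1)` changes `1 / (ĥ_0 ĥ_m)` into `1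
  -- / ĥ_m^2`.
  rw [h, oneQ, oneQ, add_right_inj]
  field_simp
  ring

end

end JacobiCubature

end

/-! ### The interpolation theorem -/

theorem mainTheorem4 (α β : ℝ) (hα : -1 < α) (hβ : -1 < β) (m : ℕ) :
    -- the explicit formula gives the unique interpolant of `f` on `X_m` in `Π*_{2m+1}`
    (∀ f : ℝ × ℝ → ℝ,
      interp α β m (starKernel α β m) f ∈ interpSpace α β m ∧
      (∀ p ∈ nodeSet α β m, interp α β m (starKernel α β m) f p = f p) ∧
      (∀ g ∈ interpSpace α β m, (∀ p ∈ nodeSet α β m, g p = f p) →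
        g = interp α β m (starKernel α β m) f)) ∧
    -- the coefficients `b_{k,m}` are positive and determined, and the kernel that they give
    -- is the explicit one
    (∀ k ≤ m, 0 < 1 / (aConst α β ^ 2 * hHat α β m k * hHat α β m m)) ∧
    (∀ b : ℕ → ℝ,
      (∀ f : ℝ × ℝ → ℝ, ∀ p ∈ nodeSet α β m,
          interp α β m (coeffKernel α β m b) f p = f p) ↔
        ∀ k ≤ m, b k = 1 / (aConst α β ^ 2 * hHat α β m k * hHat α β m m)) ∧
    (∀ x y : ℝ × ℝ, starKernel α β m x y =
      coeffKernel α β m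
        (fun k => 1 / (aConst α β ^ 2 * hHat α β m k * hHat α β m m)) x y) := by

  have hker : starKernel α β m = coeffKernel α β m
      (fun k => 1 / (aConst α β ^ 2 * hHat α β m k * hHat α β m m)) :=
    funext fun x => funext fun y => starKernel_eq_coeffKernel hα hβ m x y
  have hleft := (interpMatrix_mul_evalMatrix_eq_one_iff hα hβ m
    fun k => 1 / (aConst α β ^ 2 * hHat α β m k * hHat α β m m)).2 fun _ _ => rfl
  have hiff : ∀ b : ℕ → ℝ, (∀ f : ℝ × ℝ → ℝ, ∀ p ∈ nodeSet α β m,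
      interp α β m (coeffKernel α β m b) f p = f p) ↔
      ∀ k ≤ m, b k = 1 / (aConst α β ^ 2 * hHat α β m k * hHat α β m m) := fun b => by
    rw [interpolates_iff, evalMatrix_mul_interpMatrix_eq_one_iff hα hβ]
  refine ⟨fun f => ⟨?_, ?_, ?_⟩, fun k hk => one_div_pos.2 (oneQ_normSq_pos hα hβ hk), hiff,
    starKernel_eq_coeffKernel hα hβ m⟩
  · rw [hker]
    exact mem_interpSpace_iff.2 ⟨_, interp_coeffKernel α β m _ f⟩
  · rw [hker]
    exact (hiff _).2 (fun _ _ => rfl) f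
  · intro g hg hgf
    obtain ⟨c, hc⟩ := mem_interpSpace_iff.1 hg
    -- The node values are the evaluation matrix applied to the coefficients of `g`, so the left
    -- inverse recovers these coefficients from `f`.
    have hval : nodeValues α β m f = (evalMatrix α β m).mulVec c := by
      funext p
      rw [nodeValues, ← hgf p (mem_nodeFinset.1 p.2), hc]
      rfl
    funext x
    rw [hker, interp_coeffKernel, hval, Matrix.mulVec_mulVec, hleft, Matrix.one_mulVec, hc]
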